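/- Let $\mathcal H,\mathcal J$ be separable complex Hilbert spaces, $\mathcal H\otimes\mathcal J$ their Hilbert tensor product, $\|\cdot\|_1$ the trace norm and $\operatorname{tr}$ the trace. All sums below are finite (possibly empty) or countably infinite. A state (density operator) is a positive trace class operator of trace one; a pure state is a rank-one orthogonal projection. Definitions. A *standard decomposition* of an operator $C$ on $\mathcal H\otimes\mathcal J$ is an expansion $C=\sum_k r_k\,(X_k\otimes Y_k)$, convergent in trace norm, with $r_k\ge 0$, $\sum_k r_k<\infty$, $X_k,Y_k$ trace class on $\mathcal H,\mathcal J$ and $\|X_k\|_1\|Y_k\|_1=1$; it is *Hermitian* if all $X_k,Y_k$ are selfadjoint. A *cross trace class operator* is a trace class operator on $\mathcal H\otimes\mathcal J$ that has a standard decomposition. The projective norm $\|C\|_\pi$ of a cross trace class operator (respectively, the Hermitian projective norm $|||C|||_\pi$ of a selfadjoint cross trace class operator) is the infimum of $\sum_k r_k$ over all standard (respectively, Hermitian standard) decompositions of $C$. $C$ is *optimally decomposable* if some standard decomposition has $\sum_k r_k=\|C\|_\pi$; a selfadjoint $C$ is *$|||\cdot|||_\pi$-optimally decomposable* if some Hermitian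 standard decomposition has $\sum_k r_k=|||C|||_\pi$, and *Hermitian-optimally decomposable* if some Hermitian standard decomposition has $\sum_k r_k=\|C\|_\pi$. A *signed decomposition* of $C$ is an expansion $$C=\sum_k t_k\,(\rho_k\otimes\sigma_k),\qquad t_k\in\mathbb R,\ \sum_k|t_k|<\infty,$$ convergent in trace norm, with states $\rho_k$ of $\mathcal H$ and $\sigma_k$ of $\mathcal J$; it is *pure* if all $\rho_k,\sigma_k$ are pure states, and *positive* if all $t_k\ge 0$. **Theorem.** 1. A trace class operator on $\mathcal H\otimes\mathcal J$ is a selfadjoint cross trace class operator if and only if it has a signed decomposition, and if and only if it has a pure signed decomposition. For real $t_k$ and states $\rho_k,\sigma_k$, absolute convergence of $\sum_k t_k(\rho_k\otimes\sigma_k)$ with respect to $|||\cdot|||_\pi$, to $\|\cdot\|_\pi$, and to $\|\cdot\|_1$ are each equivalent to $\sum_k|t_k|<\infty$, and in that case convergence to a given operator $C$ in any of these norms is equivalent to convergence to $C$ in the others. For every signed decomposition of $C$, $$\operatorname{tr}(C)=\sum_k t_k,\qquad \|C\|_1\le\|C\|_\pi\le|||C|||_\pi\le\sum_k|t_k|.$$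 2. If $C=\sum_j r_j(X_j\otimes Y_j)$ is a Hermitian standard decomposition, then $C$ has a signed decomposition, and also a pure one, with $\sum_k|t_k|=\sum_j r_j$. Conversely, for every signed decomposition of $C$ there is a Hermitian standard decomposition of $C$ with $\sum_j r_j=\sum_k|t_k|$. Hence, for every selfadjoint cross trace class operator $C$, $|||C|||_\pi$ is the infimum of $\sum_k|t_k|$ over all signed decompositions of $C$, and also over all pure ones. If $C$ is $|||\cdot|||_\pi$-optimally decomposable, then it has a signed decomposition, and also a pure one, with $\sum_k|t_k|=|||C|||_\pi$. If $C$ is Hermitian-optimally decomposable, then it is $|||\cdot|||_\pi$-optimally decomposable and it has a signed decomposition, and also a pure one, with $\sum_k|t_k|=|||C|||_\pi=\|C\|_\pi$. 3. If a selfadjoint cross trace class operator $C$ is not $|||\cdot|||_\pi$-optimally decomposable, then every signed decomposition of $C$ contains both a strictly positive and a strictly negative coefficient. 4. If $\mathsf m=\min\{\dim\mathcal H,\dim\mathcal J\}<\infty$, then every selfadjoint cross trace class operator has a finite signed decomposition with at most $4\mathsf m^2$ summands. 5. For a selfadjoint cross trace class operator $P$ the following are equivalent: (P1) $P$ has a positive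 decomposition; (P2) $P$ is positive, Hermitian-optimally decomposable, and $\|P\|_\pi=\|P\|_1$; (P3) $P$ is positive, $|||\cdot|||_\pi$-optimally decomposable, and $|||P|||_\pi=\|P\|_1$; (P4) $P$ is positive, optimally decomposable, and $\|P\|_\pi=\|P\|_1$; (P5) $P$ is positive, optimally decomposable, and $|||P|||_\pi=\|P\|_\pi=\|P\|_1$. If they hold, then every positive decomposition $P=\sum_k r_k(\rho_k\otimes\sigma_k)$ is a Hermitian standard decomposition, optimal for both $\|\cdot\|_\pi$ and $|||\cdot|||_\pi$, and $\operatorname{tr}(P)=\|P\|_1=\|P\|_\pi=|||P|||_\pi=\sum_k r_k$. -/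

import Mathlib

open scoped TensorProduct InnerProductSpace ENNReal

noncomputable section TraceClass

variable {K : Type*} [NormedAddCommGroup K] [InnerProductSpace ℂ K] [CompleteSpace K]

/-- The index set of a fixed orthonormal basis of a complex Hilbert space. -/
def onbIndex (K : Type*) [NormedAddCommGroup K] [InnerProductSpace ℂ K] [CompleteSpace K] :
    Set K :=
  (exists_hilbertBasis ℂ K).choose

/-- A fixed orthonormal basis of a complex Hilbert space. -/
def onb (K : Type*) [NormedAddCommGroup K] [InnerProductSpace ℂ K] [CompleteSpace K] :
    HilbertBasis (onbIndex K) ℂ K :=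
  (exists_hilbertBasis ℂ K).choose_spec.choose

/-- The trace norm `‖S‖₁ = tr |S|`, with values in `[0, ∞]`, where `|S| = √(S* S)`.
The sum of the diagonal matrix elements of a positive operator
does not depend on the orthonormal basis. -/
def eTraceNorm (S : K →L[ℂ] K) : ℝ≥0∞ :=
  ∑' i, ENNReal.ofReal (RCLike.re ⟪onb K i, CFC.abs S (onb K i)⟫_ℂ)

/-- `S` is a trace class operator: `tr |S| < ∞`. -/
def IsTraceClass (S : K →L[ℂ] K) : Prop :=
  eTraceNorm S < ⊤

/-- The trace norm of a trace class operator. -/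
def traceNorm (S : K →L[ℂ] K) : ℝ :=
  (eTraceNorm S).toReal

/-- The trace of a trace class operator. -/
def opTrace (S : K →L[ℂ] K) : ℂ :=
  ∑' i, ⟪onb K i, S (onb K i)⟫_ℂ

/-- Density operators (states): positive trace class operators of unit trace. -/
structure IsDensityOperator (ρ : K →L[ℂ] K) : Prop where
  positive : ρ.IsPositive
  traceClass : IsTraceClass ρ
  trace_eq_one : opTrace ρ = 1

/-- Pure states: the rank-one (orthogonal) projections `|φ⟩⟨φ|`, `‖φ‖ = 1`. -/
def IsPureState (ρ : K →L[ℂ] K) : Prop :=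
  ∃ φ : K, ‖φ‖ = 1 ∧ ρ = InnerProductSpace.rankOne ℂ φ φ

/-- `∑ k, f k = C` in the sense of an extended norm `N` on operators: the (finite) partial sums
converge to `C` with respect to `N`. -/
def HasSumIn (N : (K →L[ℂ] K) → ℝ≥0∞) {ι : Type} (f : ι → K →L[ℂ] K) (C : K →L[ℂ] K) : Prop :=
  Filter.Tendsto (fun s : Finset ι => N (C - ∑ k ∈ s, f k)) Filter.atTop (nhds 0)

/-- Absolute summability of a family of operators with respect to an extended norm `N`. -/
def AbsSummableIn (N : (K →L[ℂ] K) → ℝ≥0∞) {ι : Type} (f : ι → K →L[ℂ] K) : Prop :=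
  ∑' k, N (f k) < ⊤

end TraceClass

noncomputable section HilbertTensorProduct

variable {H J : Type*}
  [NormedAddCommGroup H] [InnerProductSpace ℂ H]
  [NormedAddCommGroup J] [InnerProductSpace ℂ J]

/-- The Hilbert space tensor product: the completion of the algebraic tensor product, whose inner
product is determined by `⟪φ₁ ⊗ ψ₁, φ₂ ⊗ ψ₂⟫ = ⟪φ₁, φ₂⟫ ⟪ψ₁, ψ₂⟫`. -/
abbrev HilbertTensor (H J : Type*) [NormedAddCommGroup H] [InnerProductSpace ℂ H]
    [NormedAddCommGroup J] [InnerProductSpace ℂ J] : Type _ :=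
  UniformSpace.Completion (H ⊗[ℂ] J)

/-- The tensor product `A ⊗ B` of bounded operators, as a bounded operator on the Hilbert space
tensor product. -/
def opTensor (A : H →L[ℂ] H) (B : J →L[ℂ] J) : HilbertTensor H J →L[ℂ] HilbertTensor H J :=
  (TensorProduct.mapL A B).completion

theorem opTensor_tmul (A : H →L[ℂ] H) (B : J →L[ℂ] J) (φ : H) (ψ : J) :
    opTensor A B ((φ ⊗ₜ[ℂ] ψ : H ⊗[ℂ] J) : HilbertTensor H J) =
      ((A φ ⊗ₜ[ℂ] B ψ : H ⊗[ℂ] J) : HilbertTensor H J) := by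
  simp [opTensor]

end HilbertTensorProduct

noncomputable section CrossTraceClass

variable {H J : Type*}
  [NormedAddCommGroup H] [InnerProductSpace ℂ H] [CompleteSpace H]
  [NormedAddCommGroup J] [InnerProductSpace ℂ J] [CompleteSpace J]

/-- A standard decomposition `C = ∑ₖ rₖ (Xₖ ⊗ Yₖ)`: `rₖ ≥ 0`, `∑ₖ rₖ < ∞`, `Xₖ` and `Yₖ` trace class
with `‖Xₖ‖₁ ‖Yₖ‖₁ = 1`, the sum being (absolutely) convergent in trace norm. -/
structure IsStandardDecomposition {ι : Type} (C : HilbertTensor H J →L[ℂ] HilbertTensor H J)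
    (r : ι → ℝ) (X : ι → H →L[ℂ] H) (Y : ι → J →L[ℂ] J) : Prop where
  nonneg : ∀ k, 0 ≤ r k
  summable : Summable r
  traceClass_left : ∀ k, IsTraceClass (X k)
  traceClass_right : ∀ k, IsTraceClass (Y k)
  norm_eq_one : ∀ k, traceNorm (X k) * traceNorm (Y k) = 1
  hasSum : HasSumIn eTraceNorm (fun k => (r k : ℂ) • opTensor (X k) (Y k)) C

/-- A Hermitian standard decomposition: a standard decomposition in which all the operators
`Xₖ`, `Yₖ` are selfadjoint. -/
structure IsHermitianStandardDecomposition {ι : Type}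
    (C : HilbertTensor H J →L[ℂ] HilbertTensor H J)
    (r : ι → ℝ) (X : ι → H →L[ℂ] H) (Y : ι → J →L[ℂ] J) : Prop
    extends IsStandardDecomposition C r X Y where
  selfAdjoint_left : ∀ k, IsSelfAdjoint (X k)
  selfAdjoint_right : ∀ k, IsSelfAdjoint (Y k)

/-- Cross trace class operators: the trace class operators admitting a (finite or countably
infinite) standard decomposition. -/
def IsCrossTraceClass (C : HilbertTensor H J →L[ℂ] HilbertTensor H J) : Prop :=
  IsTraceClass C ∧ ∃ (ι : Type) (_ : Countable ι) (r : ι → ℝ) (X : ι → H →L[ℂ] H)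
    (Y : ι → J →L[ℂ] J), IsStandardDecomposition C r X Y

/-- Selfadjoint cross trace class operators. -/
def IsSelfAdjointCrossTraceClass (C : HilbertTensor H J →L[ℂ] HilbertTensor H J) : Prop :=
  IsCrossTraceClass C ∧ IsSelfAdjoint C

/-- The projective norm, with values in `[0, ∞]` (`∞` outside the cross trace class): the infimum
of `∑ₖ rₖ` over all standard decompositions. -/
def eProjNorm (C : HilbertTensor H J →L[ℂ] HilbertTensor H J) : ℝ≥0∞ :=
  sInf {x | ∃ (ι : Type) (_ : Countable ι) (r : ι → ℝ) (X : ι → H →L[ℂ] H) (Y : ι → J →L[ℂ] J),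
    IsStandardDecomposition C r X Y ∧ x = ENNReal.ofReal (∑' k, r k)}

/-- The projective norm of a cross trace class operator. -/
def projNorm (C : HilbertTensor H J →L[ℂ] HilbertTensor H J) : ℝ :=
  (eProjNorm C).toReal

/-- The Hermitian projective norm, with values in `[0, ∞]`: the infimum of `∑ₖ rₖ` over all
Hermitian standard decompositions. -/
def eHermProjNorm (C : HilbertTensor H J →L[ℂ] HilbertTensor H J) : ℝ≥0∞ :=
  sInf {x | ∃ (ι : Type) (_ : Countable ι) (r : ι → ℝ) (X : ι → H →L[ℂ] H) (Y : ι → J →L[ℂ] J),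
    IsHermitianStandardDecomposition C r X Y ∧ x = ENNReal.ofReal (∑' k, r k)}

/-- The Hermitian projective norm of a selfadjoint cross trace class operator. -/
def hermProjNorm (C : HilbertTensor H J →L[ℂ] HilbertTensor H J) : ℝ :=
  (eHermProjNorm C).toReal

/-- `C` is optimally decomposable: it has a standard decomposition with `∑ₖ rₖ = ‖C‖_π`. -/
def OptimallyDecomposable (C : HilbertTensor H J →L[ℂ] HilbertTensor H J) : Prop :=
  ∃ (ι : Type) (_ : Countable ι) (r : ι → ℝ) (X : ι → H →L[ℂ] H) (Y : ι → J →L[ℂ] J),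
    IsStandardDecomposition C r X Y ∧ projNorm C = ∑' k, r k

/-- `C` is optimally decomposable for the Hermitian projective norm: it has a Hermitian standard
decomposition in which `∑ₖ rₖ` is the Hermitian projective norm of `C`. -/
def HermNormOptimallyDecomposable (C : HilbertTensor H J →L[ℂ] HilbertTensor H J) : Prop :=
  ∃ (ι : Type) (_ : Countable ι) (r : ι → ℝ) (X : ι → H →L[ℂ] H) (Y : ι → J →L[ℂ] J),
    IsHermitianStandardDecomposition C r X Y ∧ hermProjNorm C = ∑' k, r k

/-- `C` is Hermitian-optimally decomposable: it has a Hermitian standard decomposition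
with `∑ₖ rₖ = ‖C‖_π`. -/
def HermitianOptimallyDecomposable (C : HilbertTensor H J →L[ℂ] HilbertTensor H J) : Prop :=
  ∃ (ι : Type) (_ : Countable ι) (r : ι → ℝ) (X : ι → H →L[ℂ] H) (Y : ι → J →L[ℂ] J),
    IsHermitianStandardDecomposition C r X Y ∧ projNorm C = ∑' k, r k

/-- A signed decomposition `C = ∑ₖ tₖ (ρₖ ⊗ σₖ)`: `tₖ` real, `∑ₖ |tₖ| < ∞`, `ρₖ` and `σₖ` density
operators, the sum being (absolutely) convergent in trace norm. -/
structure IsSignedDecomposition {ι : Type} (C : HilbertTensor H J →L[ℂ] HilbertTensor H J)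
    (t : ι → ℝ) (ρ : ι → H →L[ℂ] H) (σ : ι → J →L[ℂ] J) : Prop where
  summable : Summable fun k => |t k|
  density_left : ∀ k, IsDensityOperator (ρ k)
  density_right : ∀ k, IsDensityOperator (σ k)
  hasSum : HasSumIn eTraceNorm (fun k => (t k : ℂ) • opTensor (ρ k) (σ k)) C

/-- A pure-state signed decomposition: all the density operators are pure states. -/
structure IsPureSignedDecomposition {ι : Type} (C : HilbertTensor H J →L[ℂ] HilbertTensor H J)
    (t : ι → ℝ) (ρ : ι → H →L[ℂ] H) (σ : ι → J →L[ℂ] J) : Prop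
    extends IsSignedDecomposition C t ρ σ where
  pure_left : ∀ k, IsPureState (ρ k)
  pure_right : ∀ k, IsPureState (σ k)

/-- A positive decomposition: a signed decomposition with non-negative coefficients. -/
structure IsPositiveDecomposition {ι : Type} (P : HilbertTensor H J →L[ℂ] HilbertTensor H J)
    (r : ι → ℝ) (ρ : ι → H →L[ℂ] H) (σ : ι → J →L[ℂ] J) : Prop
    extends IsSignedDecomposition P r ρ σ where
  nonneg : ∀ k, 0 ≤ r k

end CrossTraceClass

/-! States have trace norm one, and a product of states is a state. So a signed decomposition
becomes a Hermitian standard one by absorbing the sign of `t k` into the left factor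
(`IsSignedDecomposition.hermitian`). Conversely, a selfadjoint `X` splits as `X⁺ - X⁻` with `‖X‖₁ =
‖X⁺‖₁ + ‖X⁻‖₁`, and a positive `P` is the sum of the rank-one operators built on the vectors `√P
eᵢ`. The coefficients then add up to exactly `‖X‖₁`, so expanding both factors of every term
(`exists_pureSignedDecomposition`) preserves the total. Hermitian, signed and pure decompositions
therefore attain the same totals, and both the infimum and its attainment transfer. A standard
decomposition that is not Hermitian is first replaced by its selfadjoint part, without control of
the total.

Since `tr C = ∑ t` and `|tr C| ≤ ‖C‖₁ ≤ ‖C‖_π ≤ |||C|||_π ≤ ∑ |t|`, coefficients of one sign turn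
the chain into equalities (`IsSignedDecomposition.tsum_abs_eq`). This gives optimality of positive
decompositions and the need for both signs when no optimum exists. For the converse, `∑ r = ‖P‖₁ =
tr P` forces every product with nonzero coefficient to have trace one, equal to its trace norm. Such
a product is positive (`IsTraceClass.nonneg_of_opTrace_eq`), hence equal to `|X| ⊗ |Y|`, a product
of states after normalisation.

If one factor has dimension `m`, at most `2 m²` fixed states span all states over `ℝ`; collecting
the other factors and splitting them by sign leaves at most `4 m²` terms
(`exists_finite_expansion`).

The analysis rests on the variational description of the trace norm. Its lower semicontinuity allows
absolutely convergent series to be manipulated in operator norm. -/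

open Filter Topology

/-! ### The trace norm: variational bounds, semicontinuity and norm properties. -/

section TraceNorm

theorem HilbertBasis.tsum_enorm_inner_sq {K : Type*} [NormedAddCommGroup K]
    [InnerProductSpace ℂ K] {ι : Type*} (b : HilbertBasis ι ℂ K) (x : K) :
    ∑' i, ‖⟪b i, x⟫_ℂ‖ₑ ^ 2 = ‖x‖ₑ ^ 2 := by
  have h := (b.hasSum_inner_mul_inner x x).mapL Complex.reCLM
  have h2 : HasSum (fun i => ‖⟪b i, x⟫_ℂ‖ ^ 2) (‖x‖ ^ 2) := by
    convert h using 1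
    · ext i
      rw [← inner_conj_symm x (b i), RCLike.conj_mul, Complex.reCLM_apply]
      norm_cast
    · rw [Complex.reCLM_apply]
      exact (inner_self_eq_norm_sq (𝕜 := ℂ) x).symm
  rw [← ofReal_norm, ← ENNReal.ofReal_pow (norm_nonneg _), ← h2.tsum_eq,
    ENNReal.ofReal_tsum_of_nonneg (fun _ => by positivity) h2.summable]
  simp_rw [ENNReal.ofReal_pow (norm_nonneg _), ofReal_norm]

variable {K : Type*} [NormedAddCommGroup K] [InnerProductSpace ℂ K] [CompleteSpace K]

/-- The Hilbert–Schmidt norm does not depend on the basis and is invariant under adjoints. -/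
theorem HilbertBasis.tsum_enorm_sq_adjoint {ι κ : Type*} (b : HilbertBasis ι ℂ K)
    (c : HilbertBasis κ ℂ K) (T : K →L[ℂ] K) :
    ∑' i, ‖T (b i)‖ₑ ^ 2 = ∑' j, ‖(star T) (c j)‖ₑ ^ 2 := by
  simp_rw [← c.tsum_enorm_inner_sq (T _), ← b.tsum_enorm_inner_sq (star T _)]
  rw [ENNReal.tsum_comm]
  congr! 5 with j i
  rw [ContinuousLinearMap.star_eq_adjoint, ContinuousLinearMap.adjoint_inner_right,
    ← inner_conj_symm, ← ofReal_norm, ← ofReal_norm, RCLike.norm_conj]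

/-- By the C*-identity only `S* S = |S|²` matters. This moves estimates on `S` into the functional
calculus of `|S|`. -/
theorem norm_mul_eq_norm_abs_mul (S Z : K →L[ℂ] K) : ‖S * Z‖ = ‖CFC.abs S * Z‖ := by
  have h : star (S * Z) * (S * Z) = star (CFC.abs S * Z) * (CFC.abs S * Z) := by
    have hs : star (CFC.abs S) = CFC.abs S := (CFC.abs_nonneg S).isSelfAdjoint
    rw [star_mul, star_mul, hs]
    calc _ = star Z * (star S * S) * Z := by simp only [mul_assoc]
      _ = _ := by rw [← CFC.abs_mul_abs]; simp only [mul_assoc]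
  have h1 := CStarRing.norm_star_mul_self (x := S * Z)
  rw [h, CStarRing.norm_star_mul_self] at h1
  exact ((mul_self_inj (norm_nonneg _) (norm_nonneg _)).1 h1).symm

/-- Approximate polar decomposition. -/
theorem exists_approx_polar (S : K →L[ℂ] K) : ∃ U : ℕ → K →L[ℂ] K, (∀ n, ‖U n‖ ≤ 1) ∧
    Tendsto (fun n => star (U n) * S) atTop (𝓝 (CFC.abs S)) ∧
    Tendsto (fun n => U n * CFC.abs S) atTop (𝓝 S) := by
  set D := CFC.abs S with hD
  have hD0 : 0 ≤ D := CFC.abs_nonneg S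
  have hDs : IsSelfAdjoint D := hD0.isSelfAdjoint
  let ε : ℕ → ℝ := fun n => 1 / ((n : ℝ) + 1)
  have hε : ∀ n, 0 < ε n := fun n => by positivity
  have hε0 : Tendsto ε atTop (𝓝 0) := tendsto_one_div_add_atTop_nhds_zero_nat
  -- `S (|S| + ε)⁻¹` replaces the partial isometry of the polar decomposition. The absolute value
  -- only serves continuity on all of `ℝ`, since the spectrum of `|S|` is nonnegative.
  let f : ℕ → ℝ → ℝ := fun n x => (|x| + ε n)⁻¹
  have hf : ∀ n, Continuous (f n) := fun n => by
    refine (continuous_abs.add continuous_const).inv₀ fun x => ?_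
    have := hε n
    exact (by positivity : |x| + ε n ≠ 0)
  let R : ℕ → K →L[ℂ] K := fun n => cfc (f n) D
  have hRs : ∀ n, star (R n) = R n := fun n => (cfc_predicate (f n) D : IsSelfAdjoint (R n))
  have hid : cfc (fun x : ℝ => x) D = D := cfc_id' ℝ D
  have hDR : ∀ n, D * R n = cfc (fun x => x * f n x) D := fun n => by
    rw [cfc_mul (fun x => x) (f n) D continuousOn_id (hf n).continuousOn, hid]
  have hDRD : ∀ n, D - D * R n * D = cfc (fun x => x - x * f n x * x) D := fun n => by
    have hc := continuous_id.mul (hf n)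
    rw [cfc_sub (fun x => x) (fun x => x * f n x * x) D continuousOn_id
      (hc.mul continuous_id).continuousOn, cfc_mul (fun x => x * f n x) (fun x => x) D
      hc.continuousOn continuousOn_id, ← hDR, hid]
  have hcomm : ∀ n, R n * D = D * R n := fun n => by
    conv_lhs => rw [← hid]
    rw [hDR, ← cfc_mul (f n) (fun x => x) D (hf n).continuousOn continuousOn_id]
    congr 1; ext x; ring
  have hbd : ∀ n, ‖D - D * R n * D‖ ≤ ε n := fun n => by
    rw [hDRD]
    refine norm_cfc_le (hε n).le fun x hx => ?_
    have hx0 : 0 ≤ x := spectrum_nonneg_of_nonneg hD0 hx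
    have he := hε n
    have : x - x * f n x * x = ε n * (x / (x + ε n)) := by
      simp only [f, abs_of_nonneg hx0]; field_simp; ring
    rw [this, Real.norm_of_nonneg (by positivity)]
    exact mul_le_of_le_one_right he.le ((div_le_one (by positivity)).2 (by linarith))
  refine ⟨fun n => S * R n, fun n => ?_, ?_, ?_⟩
  · rw [norm_mul_eq_norm_abs_mul, ← hD, hDR]
    refine norm_cfc_le zero_le_one fun x hx => ?_
    have hx0 : 0 ≤ x := spectrum_nonneg_of_nonneg hD0 hx
    have he := hε n
    simp only [f, abs_of_nonneg hx0]
    rw [Real.norm_of_nonneg (by positivity), ← div_eq_mul_inv]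
    exact (div_le_one (by positivity)).2 (by linarith)
  · refine tendsto_iff_norm_sub_tendsto_zero.2
      (squeeze_zero (fun _ => norm_nonneg _) (fun n => ?_) hε0)
    have : star (S * R n) * S = D * R n * D := by
      rw [star_mul, hRs, mul_assoc, ← CFC.abs_mul_abs, ← hD, ← mul_assoc, hcomm]
    rw [this, norm_sub_rev]; exact hbd n
  · refine tendsto_iff_norm_sub_tendsto_zero.2
      (squeeze_zero (fun _ => norm_nonneg _) (fun n => ?_) hε0)
    have : S * R n * D - S = S * (R n * D - 1) := by rw [mul_sub, mul_one, mul_assoc]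
    rw [this, norm_mul_eq_norm_abs_mul, ← hD, mul_sub, mul_one, ← mul_assoc, norm_sub_rev]
    exact hbd n

theorem ofReal_re_inner_eq_enorm_sqrt_sq {P : K →L[ℂ] K} (hP : 0 ≤ P) (x : K) :
    ENNReal.ofReal (RCLike.re ⟪x, P x⟫_ℂ) = ‖CFC.sqrt P x‖ₑ ^ 2 := by
  have hs : star (CFC.sqrt P) = CFC.sqrt P := (CFC.sqrt_nonneg P).isSelfAdjoint
  have h : ⟪x, P x⟫_ℂ = ⟪CFC.sqrt P x, CFC.sqrt P x⟫_ℂ := by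
    conv_lhs => rw [← CFC.sqrt_mul_sqrt_self P hP]
    rw [mul_apply_eq_comp, ← ContinuousLinearMap.adjoint_inner_left,
      ← ContinuousLinearMap.star_eq_adjoint, hs]
  rw [h, inner_self_eq_norm_sq, ENNReal.ofReal_pow (norm_nonneg _), ofReal_norm]

theorem eTraceNorm_eq_tsum_sqrt_abs (S : K →L[ℂ] K) :
    eTraceNorm S = ∑' i, ‖CFC.sqrt (CFC.abs S) (onb K i)‖ₑ ^ 2 := by
  simp_rw [eTraceNorm, ofReal_re_inner_eq_enorm_sqrt_sq (CFC.abs_nonneg S)]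

theorem eTraceNorm_of_nonneg {P : K →L[ℂ] K} (hP : 0 ≤ P) :
    eTraceNorm P = ∑' i, ENNReal.ofReal (RCLike.re ⟪onb K i, P (onb K i)⟫_ℂ) := by
  rw [eTraceNorm, CFC.abs_of_nonneg P hP]

/-- The trace norm of a positive operator can be computed in any orthonormal basis. -/
theorem eTraceNorm_eq_tsum_sqrt {P : K →L[ℂ] K} (hP : 0 ≤ P) {ι : Type*}
    (b : HilbertBasis ι ℂ K) : eTraceNorm P = ∑' i, ‖CFC.sqrt P (b i)‖ₑ ^ 2 := by
  rw [eTraceNorm_eq_tsum_sqrt_abs, CFC.abs_of_nonneg P hP,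
    (onb K).tsum_enorm_sq_adjoint b (CFC.sqrt P),
    (CFC.sqrt_nonneg P).isSelfAdjoint.star_eq]

theorem ENNReal.two_mul_mul_le_sq_add_sq (x y : ℝ≥0∞) : 2 * (x * y) ≤ x ^ 2 + y ^ 2 := by
  rcases eq_or_ne x ⊤ with rfl | hx
  · simp
  rcases eq_or_ne y ⊤ with rfl | hy
  · simp
  lift x to NNReal using hx
  lift y to NNReal using hy
  have := two_mul_le_add_sq x y
  rw [mul_assoc] at this
  exact_mod_cast this

/-- The Hilbert–Schmidt norm of `T W` is that of `W* T`, where the contraction acts last and is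
estimated vector by vector. -/
theorem tsum_enorm_sq_comp_le (T W : K →L[ℂ] K) (hT : star T = T) (hW : ‖W‖ ≤ 1) :
    ∑' i, ‖T (W (onb K i))‖ₑ ^ 2 ≤ ∑' i, ‖T (onb K i)‖ₑ ^ 2 := by
  have h := (onb K).tsum_enorm_sq_adjoint (onb K) (T * W)
  simp only [star_mul, hT, mul_apply_eq_comp] at h
  rw [h]
  gcongr with i
  rw [← ofReal_norm, ← ofReal_norm]
  refine ENNReal.ofReal_le_ofReal (((star W).le_opNorm _).trans ?_)
  rw [norm_star]
  exact mul_le_of_le_one_left (norm_nonneg _) hW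

theorem ContinuousLinearMap.norm_star_le_one {U : K →L[ℂ] K} (hU : ‖U‖ ≤ 1) : ‖star U‖ ≤ 1 := by
  rwa [norm_star]

theorem norm_mul_le_one {A B : K →L[ℂ] K} (hA : ‖A‖ ≤ 1) (hB : ‖B‖ ≤ 1) : ‖A * B‖ ≤ 1 :=
  (norm_mul_le _ _).trans (mul_le_one₀ hA (norm_nonneg _) hB)

theorem continuous_inner_apply {K : Type*} [NormedAddCommGroup K] [InnerProductSpace ℂ K]
    (x y : K) : Continuous fun Z : K →L[ℂ] K => ⟪x, Z y⟫_ℂ :=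
  continuous_const.inner (ContinuousLinearMap.apply ℂ K y).continuous

/-- Contractions `A`, `B` yield a lower bound of the trace norm. -/
theorem tsum_enorm_inner_le_eTraceNorm (S A B : K →L[ℂ] K) (hA : ‖A‖ ≤ 1) (hB : ‖B‖ ≤ 1) :
    ∑' i, ‖⟪A (onb K i), S (B (onb K i))⟫_ℂ‖ₑ ≤ eTraceNorm S := by
  obtain ⟨U, hU, -, hUS⟩ := exists_approx_polar S
  rw [eTraceNorm_eq_tsum_sqrt_abs]
  set T := CFC.sqrt (CFC.abs S)
  have hTs : star T = T := (CFC.sqrt_nonneg (CFC.abs S)).isSelfAdjoint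
  have hTT : T * T = CFC.abs S := CFC.sqrt_mul_sqrt_self _ (CFC.abs_nonneg S)
  set M := ∑' i, ‖T (onb K i)‖ₑ ^ 2
  refine ENNReal.summable.tsum_le_of_sum_le fun s => ?_
  have hc : Tendsto (fun n => ∑ i ∈ s, ‖⟪A (onb K i), (U n * CFC.abs S) (B (onb K i))⟫_ℂ‖ₑ) atTop
      (𝓝 (∑ i ∈ s, ‖⟪A (onb K i), S (B (onb K i))⟫_ℂ‖ₑ)) :=
    tendsto_finsetSum _ fun i _ =>
      ((continuous_inner_apply (A (onb K i)) (B (onb K i))).enorm.tendsto S).comp hUS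
  refine le_of_tendsto' hc fun n => ?_
  refine (ENNReal.sum_le_tsum s).trans ?_
  -- With `|S| = T T`, one `T` moves to each side of the inner product. After Cauchy–Schwarz and
  -- `2xy ≤ x² + y²`, both sums are Hilbert–Schmidt norms of `T` composed with a contraction.
  have h1 : ∀ i, 2 * ‖⟪A (onb K i), (U n * CFC.abs S) (B (onb K i))⟫_ℂ‖ₑ ≤
      ‖T ((star (U n) * A) (onb K i))‖ₑ ^ 2 + ‖T (B (onb K i))‖ₑ ^ 2 := fun i => by
    refine le_trans ?_ (ENNReal.two_mul_mul_le_sq_add_sq _ _)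
    gcongr
    have : ⟪A (onb K i), (U n * CFC.abs S) (B (onb K i))⟫_ℂ =
        ⟪T ((star (U n) * A) (onb K i)), T (B (onb K i))⟫_ℂ := by
      conv_rhs => rw [← hTs]
      rw [← hTT]
      simp only [mul_apply_eq_comp, ContinuousLinearMap.star_eq_adjoint,
        ContinuousLinearMap.adjoint_inner_left]
      rw [← ContinuousLinearMap.star_eq_adjoint, hTs]
    rw [this, ← ofReal_norm, ← ofReal_norm, ← ofReal_norm, ← ENNReal.ofReal_mul (norm_nonneg _)]
    exact ENNReal.ofReal_le_ofReal (norm_inner_le_norm _ _)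
  have h2 : 2 * ∑' i, ‖⟪A (onb K i), (U n * CFC.abs S) (B (onb K i))⟫_ℂ‖ₑ ≤ 2 * M := by
    rw [← ENNReal.tsum_mul_left, two_mul]
    refine (ENNReal.tsum_le_tsum h1).trans ?_
    rw [ENNReal.tsum_add]
    exact add_le_add
      (tsum_enorm_sq_comp_le T _ hTs
        (norm_mul_le_one (ContinuousLinearMap.norm_star_le_one (hU n)) hA))
      (tsum_enorm_sq_comp_le T _ hTs hB)
  exact (ENNReal.mul_le_mul_iff_right (by simp) (by simp)).1 h2

/-- Converse of the preceding bound: for the approximate polar factors `U n`, the operators `U n* S`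
tend to `|S|`. The tested expressions are linear and continuous in `S`, unlike `|S|`, which is what
subadditivity and semicontinuity need. -/
theorem eTraceNorm_le_of_forall (S : K →L[ℂ] K) (c : ℝ≥0∞)
    (h : ∀ (U : K →L[ℂ] K) (s : Finset (onbIndex K)), ‖U‖ ≤ 1 →
      ‖∑ i ∈ s, ⟪U (onb K i), S (onb K i)⟫_ℂ‖ₑ ≤ c) : eTraceNorm S ≤ c := by
  obtain ⟨U, hU, hUS, -⟩ := exists_approx_polar S
  refine ENNReal.summable.tsum_le_of_sum_le fun s => ?_
  rw [← ENNReal.ofReal_sum_of_nonneg fun i _ =>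
    (((ContinuousLinearMap.nonneg_iff_isPositive _).1 (CFC.abs_nonneg S)).re_inner_nonneg_right _)]
  have hcont : Continuous fun Z : K →L[ℂ] K =>
      ENNReal.ofReal (∑ i ∈ s, RCLike.re ⟪onb K i, Z (onb K i)⟫_ℂ) :=
    ENNReal.continuous_ofReal.comp (continuous_finsetSum _ fun i _ =>
      RCLike.continuous_re.comp (continuous_inner_apply (onb K i) (onb K i)))
  refine le_of_tendsto' ((hcont.tendsto _).comp hUS) fun n => ?_
  refine le_trans ?_ (h (U n) s (hU n))
  rw [← ofReal_norm]
  refine ENNReal.ofReal_le_ofReal ?_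
  simp only [mul_apply_eq_comp, ContinuousLinearMap.star_eq_adjoint,
        ContinuousLinearMap.adjoint_inner_right]
  rw [← map_sum]
  exact RCLike.re_le_norm _

/-- Lower semicontinuity of the trace norm. -/
theorem eTraceNorm_le_of_tendsto {α : Type*} {l : Filter α} [l.NeBot] {f : α → K →L[ℂ] K}
    {S : K →L[ℂ] K} {c : ℝ≥0∞} (hf : Tendsto f l (𝓝 S)) (h : ∀ᶠ a in l, eTraceNorm (f a) ≤ c) :
    eTraceNorm S ≤ c := by
  refine eTraceNorm_le_of_forall S c fun U s hU => ?_
  have hcont : Continuous fun Z : K →L[ℂ] K =>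
      ‖∑ i ∈ s, ⟪U (onb K i), Z (onb K i)⟫_ℂ‖ₑ :=
    (continuous_finsetSum _ fun i _ => continuous_inner_apply (U (onb K i)) (onb K i)).enorm
  refine le_of_tendsto ((hcont.tendsto _).comp hf) (h.mono fun a ha => ?_)
  refine le_trans ?_ ((tsum_enorm_inner_le_eTraceNorm (f a) U 1 hU
    ContinuousLinearMap.norm_id_le).trans ha)
  exact (enorm_sum_le _ _).trans (ENNReal.sum_le_tsum s)

@[simp]
theorem eTraceNorm_zero : eTraceNorm (0 : K →L[ℂ] K) = 0 := by simp [eTraceNorm]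

theorem eTraceNorm_add_le (S T : K →L[ℂ] K) :
    eTraceNorm (S + T) ≤ eTraceNorm S + eTraceNorm T := by
  refine eTraceNorm_le_of_forall _ _ fun U s hU => ?_
  have key : ∀ S : K →L[ℂ] K, ‖∑ i ∈ s, ⟪U (onb K i), S (onb K i)⟫_ℂ‖ₑ ≤ eTraceNorm S := fun S =>
    ((enorm_sum_le _ _).trans (ENNReal.sum_le_tsum s)).trans
      (tsum_enorm_inner_le_eTraceNorm S U 1 hU ContinuousLinearMap.norm_id_le)
  simp only [add_apply, inner_add_right, Finset.sum_add_distrib]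
  exact (enorm_add_le _ _).trans (add_le_add (key S) (key T))

@[simp]
theorem eTraceNorm_star (S : K →L[ℂ] K) : eTraceNorm (star S) = eTraceNorm S := by
  have key : ∀ S : K →L[ℂ] K, eTraceNorm (star S) ≤ eTraceNorm S := fun S => by
    refine eTraceNorm_le_of_forall _ _ fun U s hU => ?_
    refine le_trans ?_ (tsum_enorm_inner_le_eTraceNorm S 1 U ContinuousLinearMap.norm_id_le hU)
    refine (enorm_sum_le _ _).trans (le_trans (Finset.sum_le_sum fun i _ => ?_)
      (ENNReal.sum_le_tsum s))
    rw [ContinuousLinearMap.star_eq_adjoint, ContinuousLinearMap.adjoint_inner_right,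
      ← inner_conj_symm, ← ofReal_norm, RCLike.norm_conj, ofReal_norm]
    rfl
  exact le_antisymm (key S) (by simpa using key (star S))

theorem eTraceNorm_smul (c : ℂ) (S : K →L[ℂ] K) : eTraceNorm (c • S) = ‖c‖ₑ * eTraceNorm S := by
  rw [eTraceNorm, eTraceNorm, CFC.abs_smul, ← ENNReal.tsum_mul_left]
  congr! 2 with i
  rw [← ofReal_norm, ← ENNReal.ofReal_mul (norm_nonneg _)]
  congr 1
  rw [smul_apply, ← Complex.coe_smul, inner_smul_right]
  exact Complex.re_ofReal_mul _ _

theorem eTraceNorm_sum_le {ι : Type*} (s : Finset ι) (f : ι → K →L[ℂ] K) :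
    eTraceNorm (∑ i ∈ s, f i) ≤ ∑ i ∈ s, eTraceNorm (f i) := by
  classical
  induction s using Finset.induction_on with
  | empty => simp
  | insert a s ha ih =>
    rw [Finset.sum_insert ha, Finset.sum_insert ha]
    exact (eTraceNorm_add_le _ _).trans (add_le_add le_rfl ih)

/-- For `T = √|S|`, `‖S‖ = ‖T‖²`, and the operator norm of `T` is at most its Hilbert–Schmidt norm.
-/
theorem enorm_le_eTraceNorm (S : K →L[ℂ] K) : ‖S‖ₑ ≤ eTraceNorm S := by
  rw [eTraceNorm_eq_tsum_sqrt_abs]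
  set T := CFC.sqrt (CFC.abs S) with hT
  have hTs : star T = T := (CFC.sqrt_nonneg (CFC.abs S)).isSelfAdjoint
  have hTT : T * T = CFC.abs S := CFC.sqrt_mul_sqrt_self _ (CFC.abs_nonneg S)
  rcases eq_or_ne (∑' i, ‖T (onb K i)‖ₑ ^ 2) ⊤ with h | h
  · simp [h]
  set M := ∑' i, ‖T (onb K i)‖ₑ ^ 2
  have hx : ∀ x, ‖T x‖ₑ ^ 2 ≤ M * ‖x‖ₑ ^ 2 := fun x => by
    rw [← (onb K).tsum_enorm_inner_sq, ← ENNReal.tsum_mul_right]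
    gcongr with i
    have hi : ⟪onb K i, T x⟫_ℂ = ⟪T (onb K i), x⟫_ℂ := by
      rw [← ContinuousLinearMap.adjoint_inner_left, ← ContinuousLinearMap.star_eq_adjoint, hTs]
    rw [hi, ← mul_pow, ← ofReal_norm, ← ofReal_norm, ← ofReal_norm,
      ← ENNReal.ofReal_mul (norm_nonneg _)]
    exact pow_le_pow_left' (ENNReal.ofReal_le_ofReal (norm_inner_le_norm _ _)) 2
  have hx' : ∀ x, ‖T x‖ ≤ √M.toReal * ‖x‖ := fun x => by
    refine (sq_le_sq₀ (norm_nonneg _) (by positivity)).1 ?_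
    rw [mul_pow, Real.sq_sqrt ENNReal.toReal_nonneg]
    have := ENNReal.toReal_mono (ENNReal.mul_ne_top h (by simp)) (hx x)
    simpa [ENNReal.toReal_mul] using this
  have h1 : ‖S‖ = ‖T‖ * ‖T‖ := by
    rw [← CFC.norm_abs (a := S), ← hTT, ← CStarRing.norm_star_mul_self, hTs]
  rw [← ofReal_norm, h1]
  refine ENNReal.ofReal_le_of_le_toReal ?_
  have h2 := T.opNorm_le_bound (Real.sqrt_nonneg _) hx'
  calc ‖T‖ * ‖T‖ ≤ √M.toReal * √M.toReal := by gcongr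
    _ = _ := Real.mul_self_sqrt ENNReal.toReal_nonneg

end TraceNorm

/-! ### The trace, density operators, and equality of trace and trace norm. -/

section Trace

variable {K : Type*} [NormedAddCommGroup K] [InnerProductSpace ℂ K] [CompleteSpace K]

theorem IsTraceClass.ne_top {S : K →L[ℂ] K} (hS : IsTraceClass S) : eTraceNorm S ≠ ⊤ :=
  LT.lt.ne hS

theorem IsTraceClass.ofReal_traceNorm {S : K →L[ℂ] K} (hS : IsTraceClass S) :
    ENNReal.ofReal (traceNorm S) = eTraceNorm S :=
  ENNReal.ofReal_toReal hS.ne_top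

theorem traceNorm_nonneg (S : K →L[ℂ] K) : 0 ≤ traceNorm S := ENNReal.toReal_nonneg

theorem traceNorm_smul (c : ℂ) (S : K →L[ℂ] K) : traceNorm (c • S) = ‖c‖ * traceNorm S := by
  simp [traceNorm, eTraceNorm_smul, ENNReal.toReal_mul]

theorem IsTraceClass.smul {S : K →L[ℂ] K} (hS : IsTraceClass S) (c : ℂ) :
    IsTraceClass (c • S) := by
  rw [IsTraceClass, eTraceNorm_smul]
  exact ENNReal.mul_lt_top (by simp) hS

theorem IsTraceClass.add {S T : K →L[ℂ] K} (hS : IsTraceClass S) (hT : IsTraceClass T) :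
    IsTraceClass (S + T) :=
  (eTraceNorm_add_le S T).trans_lt (ENNReal.add_lt_top.2 ⟨hS, hT⟩)

theorem isTraceClass_star {S : K →L[ℂ] K} (hS : IsTraceClass S) : IsTraceClass (star S) := by
  rwa [IsTraceClass, eTraceNorm_star]

theorem tsum_enorm_inner_onb_le (S : K →L[ℂ] K) :
    ∑' i, ‖⟪onb K i, S (onb K i)⟫_ℂ‖ₑ ≤ eTraceNorm S :=
  tsum_enorm_inner_le_eTraceNorm S 1 1 ContinuousLinearMap.norm_id_le ContinuousLinearMap.norm_id_le

theorem IsTraceClass.hasSum_opTrace {S : K →L[ℂ] K} (hS : IsTraceClass S) :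
    HasSum (fun i => ⟪onb K i, S (onb K i)⟫_ℂ) (opTrace S) :=
  (Summable.of_enorm ((tsum_enorm_inner_onb_le S).trans_lt hS).ne).hasSum

theorem enorm_opTrace_le (S : K →L[ℂ] K) : ‖opTrace S‖ₑ ≤ eTraceNorm S :=
  enorm_tsum_le_tsum_enorm.trans (tsum_enorm_inner_onb_le S)

theorem IsTraceClass.norm_opTrace_le {S : K →L[ℂ] K} (hS : IsTraceClass S) :
    ‖opTrace S‖ ≤ traceNorm S := by
  have := ENNReal.toReal_mono hS.ne_top (enorm_opTrace_le S)
  rwa [toReal_enorm] at this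

theorem IsTraceClass.opTrace_add {S T : K →L[ℂ] K} (hS : IsTraceClass S) (hT : IsTraceClass T) :
    opTrace (S + T) = opTrace S + opTrace T := by
  rw [← (hS.hasSum_opTrace.add hT.hasSum_opTrace).tsum_eq]
  simp [opTrace]

theorem opTrace_smul (c : ℂ) (S : K →L[ℂ] K) : opTrace (c • S) = c * opTrace S := by
  simp [opTrace, tsum_mul_left]

theorem IsTraceClass.opTrace_sub {S T : K →L[ℂ] K} (hS : IsTraceClass S) (hT : IsTraceClass T) :
    opTrace (S - T) = opTrace S - opTrace T := by
  have := hS.opTrace_add (hT.smul (-1))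
  rw [opTrace_smul] at this
  simpa [sub_eq_add_neg] using this

theorem opTrace_of_nonneg {P : K →L[ℂ] K} (hP : 0 ≤ P) :
    opTrace P = traceNorm P := by
  have hpos := (ContinuousLinearMap.nonneg_iff_isPositive P).1 hP
  have h1 : ∀ i, ⟪onb K i, P (onb K i)⟫_ℂ = (RCLike.re ⟪onb K i, P (onb K i)⟫_ℂ : ℝ) := fun i => by
    obtain ⟨-, h3⟩ := Complex.nonneg_iff.1 (hpos.inner_nonneg_right (onb K i))
    exact Complex.ext (by simp) (by simpa using h3.symm)
  rw [traceNorm, eTraceNorm_of_nonneg hP, ENNReal.tsum_toReal_eq fun _ => by simp, opTrace]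
  rw [Complex.ofReal_tsum]
  congr 1
  ext i
  rw [ENNReal.toReal_ofReal (hpos.re_inner_nonneg_right _), ← h1]

/-- On positive operators trace and trace norm agree, so one extended real equation encodes both
trace class and unit trace. -/
theorem isDensityOperator_iff {ρ : K →L[ℂ] K} :
    IsDensityOperator ρ ↔ 0 ≤ ρ ∧ eTraceNorm ρ = 1 := by
  rw [ContinuousLinearMap.nonneg_iff_isPositive]
  refine ⟨fun h => ⟨h.positive, ?_⟩, fun ⟨h1, h2⟩ => ?_⟩
  · have := opTrace_of_nonneg ((ContinuousLinearMap.nonneg_iff_isPositive _).2 h.positive)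
    rw [h.trace_eq_one] at this
    rw [← h.traceClass.ofReal_traceNorm, Complex.ofReal_eq_one.1 this.symm, ENNReal.ofReal_one]
  · have ht : IsTraceClass ρ := by simp [IsTraceClass, h2]
    refine ⟨h1, ht, ?_⟩
    rw [opTrace_of_nonneg ((ContinuousLinearMap.nonneg_iff_isPositive _).2 h1), traceNorm, h2]
    simp

theorem IsDensityOperator.nonneg {ρ : K →L[ℂ] K} (h : IsDensityOperator ρ) : 0 ≤ ρ :=
  (isDensityOperator_iff.1 h).1

theorem IsDensityOperator.eTraceNorm_eq_one {ρ : K →L[ℂ] K} (h : IsDensityOperator ρ) :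
    eTraceNorm ρ = 1 :=
  (isDensityOperator_iff.1 h).2

theorem IsDensityOperator.traceNorm_eq_one {ρ : K →L[ℂ] K} (h : IsDensityOperator ρ) :
    traceNorm ρ = 1 := by
  simp [traceNorm, h.eTraceNorm_eq_one]

theorem nonneg_rankOne_self {K : Type*} [NormedAddCommGroup K] [InnerProductSpace ℂ K]
    (φ : K) : 0 ≤ InnerProductSpace.rankOne ℂ φ φ :=
  (ContinuousLinearMap.nonneg_iff_isPositive _).2 (InnerProductSpace.isPositive_rankOne_self φ)

theorem eTraceNorm_rankOne_self (φ : K) :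
    eTraceNorm (InnerProductSpace.rankOne ℂ φ φ) = ‖φ‖ₑ ^ 2 := by
  rw [eTraceNorm_of_nonneg (nonneg_rankOne_self φ), ← (onb K).tsum_enorm_inner_sq φ]
  congr! 2 with i
  rw [InnerProductSpace.rankOne_apply, inner_smul_right, ← inner_conj_symm, RCLike.conj_mul,
    ← ofReal_norm, ← ENNReal.ofReal_pow (norm_nonneg _)]
  norm_cast

theorem IsPureState.isDensityOperator {π : K →L[ℂ] K} (h : IsPureState π) :
    IsDensityOperator π := by
  obtain ⟨φ, hφ, rfl⟩ := h
  refine isDensityOperator_iff.2 ⟨nonneg_rankOne_self φ, ?_⟩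
  rw [eTraceNorm_rankOne_self, ← ofReal_norm, hφ]
  simp

theorem hasSum_inner_rankOne (u v : K) :
    HasSum (fun i => ⟪onb K i, InnerProductSpace.rankOne ℂ u v (onb K i)⟫_ℂ) ⟪v, u⟫_ℂ := by
  have h := (onb K).hasSum_inner_mul_inner v u
  simpa only [InnerProductSpace.rankOne_apply, inner_smul_right] using h

/-- A trace class operator whose trace equals its trace norm is positive. -/
theorem IsTraceClass.nonneg_of_opTrace_eq {S : K →L[ℂ] K} (hS : IsTraceClass S)
    (h : opTrace S = traceNorm S) : 0 ≤ S := by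
  -- The isometry `1 + (z - 1) P`, which multiplies `φ` by `z` and fixes its complement, leaves
  -- `|S|` unchanged on left multiplication and adds `(z - 1) ⟪φ, S φ⟫` to the trace. As the trace
  -- already equals the trace norm, its real part cannot grow.
  have key : ∀ (φ : K) (z : ℂ), ‖φ‖ = 1 → ‖z‖ = 1 →
      ((z - 1) * ⟪φ, S φ⟫_ℂ).re ≤ 0 := by
    intro φ z hφ hz
    set P := InnerProductSpace.rankOne ℂ φ φ with hP
    have hPs : star P = P := (nonneg_rankOne_self φ).isSelfAdjoint
    have hPP : P * P = P := InnerProductSpace.isIdempotentElem_rankOne_self hφ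
    have hzz : star z * z = 1 := by
      rw [Complex.star_def, Complex.conj_mul', hz]; simp
    have hU : star (1 + (z - 1) • P) * (1 + (z - 1) • P) = 1 := by
      rw [star_add, star_one, star_smul, hPs, add_mul, mul_add, mul_add, one_mul, one_mul, mul_one,
        smul_mul_smul_comm, hPP, star_sub, star_one]
      have : (star z - 1) * (z - 1) = - (z - 1) - (star z - 1) := by linear_combination hzz
      rw [this]
      module
    have hN : eTraceNorm ((1 + (z - 1) • P) * S) = eTraceNorm S := by
      have : CFC.abs ((1 + (z - 1) • P) * S) = CFC.abs S := by
        rw [CFC.abs, CFC.abs, star_mul, mul_assoc, ← mul_assoc (star (1 + _)), hU, one_mul]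
      rw [eTraceNorm, this, eTraceNorm]
    have hPS : P * S = InnerProductSpace.rankOne ℂ φ (star S φ) := by
      ext x
      simp [hP, ContinuousLinearMap.star_eq_adjoint, ContinuousLinearMap.adjoint_inner_left]
    have hT : opTrace ((1 + (z - 1) • P) * S) = opTrace S + (z - 1) * ⟪φ, S φ⟫_ℂ := by
      have h1 := hS.hasSum_opTrace.add ((hasSum_inner_rankOne φ (star S φ)).mul_left (z - 1))
      rw [ContinuousLinearMap.star_eq_adjoint, ContinuousLinearMap.adjoint_inner_left] at h1
      rw [← h1.tsum_eq, opTrace, add_mul, one_mul, smul_mul_assoc, hPS]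
      simp [ContinuousLinearMap.star_eq_adjoint]
    have hle := IsTraceClass.norm_opTrace_le (S := (1 + (z - 1) • P) * S)
      (by rw [IsTraceClass, hN]; exact hS)
    rw [hT, traceNorm, hN, h] at hle
    have := (Complex.re_le_norm _).trans hle
    rw [Complex.add_re, Complex.ofReal_re, traceNorm] at this
    linarith
  rw [ContinuousLinearMap.nonneg_iff_isPositive, ContinuousLinearMap.isPositive_iff_complex]
  have key2 : ∀ φ : K, ‖φ‖ = 1 → ⟪φ, S φ⟫_ℂ = (‖⟪φ, S φ⟫_ℂ‖ : ℝ) := by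
    intro φ hφ
    set w := ⟪φ, S φ⟫_ℂ
    rcases eq_or_ne w 0 with hw | hw
    · simp [hw]
    have hw' : (‖w‖ : ℂ) ≠ 0 := by simpa using hw
    -- This `z` rotates `w` onto the positive axis, so the inequality reads `‖w‖ ≤ re w`.
    have h1 := key φ (star w / ‖w‖) hφ (by simp [hw])
    have h2 : (star w / ‖w‖ - 1) * w = ((‖w‖ : ℝ) : ℂ) - w := by
      rw [sub_mul, div_mul_eq_mul_div, Complex.star_def, Complex.conj_mul']
      field_simp
    change ((star w / ‖w‖ - 1) * w).re ≤ 0 at h1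
    rw [h2, Complex.sub_re, Complex.ofReal_re, sub_nonpos] at h1
    have h3 := le_antisymm h1 (Complex.re_le_norm w)
    exact Complex.ext (by simp [h3]) (by
      have := Complex.sq_norm w
      rw [Complex.normSq_apply, h3] at this
      simp
      nlinarith)
  intro x
  have hx : ∃ r : ℝ, 0 ≤ r ∧ ⟪S x, x⟫_ℂ = r := by
    rcases eq_or_ne x 0 with rfl | hx
    · exact ⟨0, le_rfl, by simp⟩
    have hx' : (‖x‖ : ℂ) ≠ 0 := by simpa using hx
    have h1 := key2 (((‖x‖ : ℂ)⁻¹) • x) (by simp [norm_smul, hx])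
    set r := ‖⟪((‖x‖ : ℂ)⁻¹) • x, S (((‖x‖ : ℂ)⁻¹) • x)⟫_ℂ‖
    refine ⟨‖x‖ ^ 2 * r, by positivity, ?_⟩
    rw [map_smul, inner_smul_left, inner_smul_right] at h1
    have h2 : ⟪x, S x⟫_ℂ = (‖x‖ ^ 2 * r : ℝ) := by
      push_cast
      rw [← h1]
      simp
      field_simp
    rw [← inner_conj_symm, h2, Complex.conj_ofReal]
  obtain ⟨r, hr, hr'⟩ := hx
  rw [hr']
  exact ⟨by simp, by simpa using hr⟩

end Trace

/-! ### Series of operators: operator norm versus trace norm convergence. -/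

section Sums

/-- Unconditional convergence of a series of operators with respect to the operator norm. -/
def OpHasSum {K : Type*} [NormedAddCommGroup K] [InnerProductSpace ℂ K] {ι : Type*}
    (f : ι → K →L[ℂ] K) (C : K →L[ℂ] K) : Prop :=
  HasSum f C

namespace OpHasSum

variable {K : Type*} [NormedAddCommGroup K] [InnerProductSpace ℂ K] {ι κ : Type*}
  {f g : ι → K →L[ℂ] K} {C D : K →L[ℂ] K}

theorem congr (h : OpHasSum f C) (hfg : ∀ k, f k = g k) (hCD : C = D) : OpHasSum g D := by
  rwa [← funext hfg, ← hCD]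

theorem unique (h : OpHasSum f C) (h' : OpHasSum f D) : C = D := HasSum.unique h h'

theorem const_smul (h : OpHasSum f C) (c : ℂ) : OpHasSum (fun k => c • f k) (c • C) :=
  HasSum.const_smul c h

theorem add (h : OpHasSum f C) (h' : OpHasSum g D) : OpHasSum (fun k => f k + g k) (C + D) :=
  HasSum.add h h'

theorem sumElim {g : κ → K →L[ℂ] K} (h : OpHasSum f C) (h' : OpHasSum g D) :
    OpHasSum (Sum.elim f g) (C + D) :=
  HasSum.sum h h'

theorem of_fintype [Fintype ι] (f : ι → K →L[ℂ] K) : OpHasSum f (∑ k, f k) := hasSum_fintype f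

theorem sum {s : Finset κ} {f : κ → ι → K →L[ℂ] K} {C : κ → K →L[ℂ] K}
    (h : ∀ i ∈ s, OpHasSum (f i) (C i)) : OpHasSum (fun k => ∑ i ∈ s, f i k) (∑ i ∈ s, C i) :=
  hasSum_sum h

theorem map {E : Type*} [NormedAddCommGroup E] {f : ι → E} {x : E} (h : HasSum f x)
    (Φ : E → K →L[ℂ] K) (hΦ : ∀ x y, Φ (x + y) = Φ x + Φ y) (c : ℝ)
    (hc : ∀ x, ‖Φ x‖ ≤ c * ‖x‖) : OpHasSum (fun k => Φ (f k)) (Φ x) :=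
  HasSum.map h (AddMonoidHom.mk' Φ hΦ) (AddMonoidHomClass.continuous_of_bound _ c hc)

theorem compl (h : OpHasSum f C) (s : Finset ι) :
    OpHasSum (fun k : {k // k ∉ s} => f k) (C - ∑ k ∈ s, f k) :=
  s.hasSum_compl_iff.2 (by rwa [sub_add_cancel])

variable [CompleteSpace K]

theorem star (h : OpHasSum f C) : OpHasSum (fun k => Star.star (f k)) (Star.star C) :=
  HasSum.star h

theorem isSelfAdjoint (h : OpHasSum f C) (hf : ∀ k, IsSelfAdjoint (f k)) : IsSelfAdjoint C :=
  (h.star.congr (fun k => (hf k).star_eq) rfl).unique h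

theorem nonneg (h : OpHasSum f C) (hf : ∀ k, 0 ≤ f k) : 0 ≤ C :=
  CStarAlgebra.isClosed_nonneg.mem_of_tendsto h (Eventually.of_forall fun _ =>
    Finset.sum_nonneg fun k _ => hf k)

theorem eTraceNorm_le (h : OpHasSum f C) : eTraceNorm C ≤ ∑' k, eTraceNorm (f k) :=
  eTraceNorm_le_of_tendsto h (Eventually.of_forall fun s =>
    (eTraceNorm_sum_le s f).trans (ENNReal.sum_le_tsum s))

end OpHasSum

variable {K : Type*} [NormedAddCommGroup K] [InnerProductSpace ℂ K] [CompleteSpace K]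

theorem summable_norm_of_tsum_eTraceNorm {ι : Type*} {f : ι → K →L[ℂ] K}
    (hf : ∑' k, eTraceNorm (f k) ≠ ⊤) : Summable fun k => ‖f k‖ :=
  tsum_enorm_ne_top_iff_summable_norm.1
    (ne_top_of_le_ne_top hf (ENNReal.tsum_le_tsum fun k => enorm_le_eTraceNorm (f k)))

theorem exists_opHasSum {ι : Type*} {f : ι → K →L[ℂ] K} (hf : ∑' k, eTraceNorm (f k) ≠ ⊤) :
    ∃ C, OpHasSum f C :=
  ⟨_, (summable_norm_of_tsum_eTraceNorm hf).of_norm.hasSum⟩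

/-- Absolute summability already provides a sum; the iterated sums only identify its value. -/
theorem opHasSum_sigma_prod {κ : Type*} {ι₁ ι₂ : κ → Type*} {g : (Σ k, ι₁ k × ι₂ k) → K →L[ℂ] K}
    {g₁ : ∀ k, ι₁ k → K →L[ℂ] K} {g₀ : κ → K →L[ℂ] K} {C : K →L[ℂ] K}
    (hs : ∑' p, eTraceNorm (g p) ≠ ⊤) (h₂ : ∀ k i, OpHasSum (fun j => g ⟨k, i, j⟩) (g₁ k i))
    (h₁ : ∀ k, OpHasSum (g₁ k) (g₀ k)) (h₀ : OpHasSum g₀ C) : OpHasSum g C := by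
  have hs := (summable_norm_of_tsum_eTraceNorm hs).of_norm
  refine HasSum.sigma_of_hasSum h₀ (fun k => ?_) hs
  have hk : Summable fun p : ι₁ k × ι₂ k => g ⟨k, p⟩ := hs.sigma_factor k
  rw [← (hk.hasSum.prod_fiberwise (h₂ k)).unique (h₁ k)]
  exact hk.hasSum

variable {ι : Type} {f : ι → K →L[ℂ] K} {C : K →L[ℂ] K}

theorem HasSumIn.opHasSum (h : HasSumIn eTraceNorm f C) : OpHasSum f C := by
  rw [OpHasSum, HasSum, SummationFilter.unconditional_filter]
  refine tendsto_iff_edist_tendsto_0.2 ?_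
  refine tendsto_of_tendsto_of_tendsto_of_le_of_le tendsto_const_nhds h (fun _ => zero_le) fun s => ?_
  rw [edist_comm, edist_eq_enorm_sub]
  exact enorm_le_eTraceNorm _

/-- A remainder is the operator norm sum of the remaining terms, so lower semicontinuity bounds its
trace norm by the tail of a convergent series. -/
theorem OpHasSum.hasSumIn (h : OpHasSum f C) (hf : ∑' k, eTraceNorm (f k) ≠ ⊤) :
    HasSumIn eTraceNorm f C :=
  tendsto_of_tendsto_of_tendsto_of_le_of_le tendsto_const_nhds
    (ENNReal.tendsto_tsum_compl_atTop_zero hf) (fun _ => zero_le) fun s => (h.compl s).eTraceNorm_le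

/-- The trace is controlled by the trace norm, not by the operator norm, so the limit is taken
through `OpHasSum.hasSumIn`. -/
theorem OpHasSum.hasSum_opTrace (h : OpHasSum f C) (hf : ∑' k, eTraceNorm (f k) ≠ ⊤) :
    HasSum (fun k => opTrace (f k)) (opTrace C) := by
  have hk : ∀ k, IsTraceClass (f k) := fun k => lt_top_iff_ne_top.2 (ENNReal.ne_top_of_tsum_ne_top hf k)
  have hC : IsTraceClass C := h.eTraceNorm_le.trans_lt hf.lt_top
  have hs : ∀ s : Finset ι, IsTraceClass (∑ k ∈ s, f k) ∧
      opTrace (∑ k ∈ s, f k) = ∑ k ∈ s, opTrace (f k) := fun s => by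
    classical
    induction s using Finset.induction_on with
    | empty => simp [IsTraceClass, opTrace]
    | insert a s ha ih =>
      rw [Finset.sum_insert ha, Finset.sum_insert ha, (hk a).opTrace_add ih.1, ih.2]
      exact ⟨(hk a).add ih.1, rfl⟩
  rw [HasSum, SummationFilter.unconditional_filter]
  refine tendsto_iff_edist_tendsto_0.2 ?_
  refine tendsto_of_tendsto_of_tendsto_of_le_of_le tendsto_const_nhds (h.hasSumIn hf)
    (fun _ => zero_le) fun s => ?_
  dsimp only
  rw [edist_comm, edist_eq_enorm_sub, ← (hs s).2, ← hC.opTrace_sub (hs s).1]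
  exact enorm_opTrace_le _

end Sums

/-! ### Identifying absolute values and square roots by uniqueness. -/

section SquareRoot

variable {K : Type*} [NormedAddCommGroup K] [InnerProductSpace ℂ K] [CompleteSpace K]

theorem ContinuousLinearMap.star_mul_self_nonneg (T : K →L[ℂ] K) : 0 ≤ star T * T :=
  _root_.star_mul_self_nonneg T

theorem ContinuousLinearMap.eq_of_mul_self_eq {S D : K →L[ℂ] K} (hD : 0 ≤ D) (hS : 0 ≤ S)
    (h : D * D = star S * S) : D = S := by
  rw [hS.isSelfAdjoint.star_eq] at h
  rw [← CFC.sqrt_unique h hD, CFC.sqrt_mul_self S hS]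

/-- The trace norm of `S` in terms of `|S|` and its square root `R`, in any orthonormal basis. -/
theorem eTraceNorm_eq_tsum_of_mul_self_eq {S D R : K →L[ℂ] K} (hR : 0 ≤ R) (hRD : R * R = D)
    (hD : 0 ≤ D) (hDS : D * D = star S * S) {ι : Type*} (b : HilbertBasis ι ℂ K) :
    eTraceNorm S = ∑' i, ‖R (b i)‖ₑ ^ 2 := by
  have h1 : CFC.abs S = D := CFC.sqrt_unique hDS hD
  have h2 : CFC.sqrt D = R := CFC.sqrt_unique hRD hR
  rw [← h2, ← eTraceNorm_eq_tsum_sqrt hD, eTraceNorm_of_nonneg hD, eTraceNorm, h1]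

end SquareRoot

/-! ### Tensor products of operators: bases, positivity, trace norm. -/

section Tensor

variable {H J : Type*}
  [NormedAddCommGroup H] [InnerProductSpace ℂ H]
  [NormedAddCommGroup J] [InnerProductSpace ℂ J]

/-- Operators on the Hilbert tensor product are determined by their values on product vectors. -/
theorem HilbertTensor.clm_ext {F : Type*} [NormedAddCommGroup F] [NormedSpace ℂ F]
    {S T : HilbertTensor H J →L[ℂ] F}
    (h : ∀ (φ : H) (ψ : J), S ((φ ⊗ₜ[ℂ] ψ : H ⊗[ℂ] J) : HilbertTensor H J) =
      T ((φ ⊗ₜ[ℂ] ψ : H ⊗[ℂ] J) : HilbertTensor H J)) : S = T := by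
  ext x
  induction x using UniformSpace.Completion.induction_on with
  | hp => exact isClosed_eq S.continuous T.continuous
  | ih x =>
    induction x using TensorProduct.induction_on with
    | zero => rw [UniformSpace.Completion.coe_zero, map_zero, map_zero]
    | tmul φ ψ => exact h φ ψ
    | add x y hx hy => rw [UniformSpace.Completion.coe_add, map_add, map_add, hx, hy]

theorem opTensor_add_left (A A' : H →L[ℂ] H) (B : J →L[ℂ] J) :
    opTensor (A + A') B = opTensor A B + opTensor A' B :=
  HilbertTensor.clm_ext fun φ ψ => by
    simp [opTensor_tmul, TensorProduct.add_tmul, UniformSpace.Completion.coe_add]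

theorem opTensor_add_right (A : H →L[ℂ] H) (B B' : J →L[ℂ] J) :
    opTensor A (B + B') = opTensor A B + opTensor A B' :=
  HilbertTensor.clm_ext fun φ ψ => by
    simp [opTensor_tmul, TensorProduct.tmul_add, UniformSpace.Completion.coe_add]

theorem opTensor_smul_left (c : ℂ) (A : H →L[ℂ] H) (B : J →L[ℂ] J) :
    opTensor (c • A) B = c • opTensor A B :=
  HilbertTensor.clm_ext fun φ ψ => by
    rw [smul_apply, opTensor_tmul, opTensor_tmul, smul_apply, ← TensorProduct.smul_tmul',
      UniformSpace.Completion.coe_smul]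

theorem opTensor_smul_right (c : ℂ) (A : H →L[ℂ] H) (B : J →L[ℂ] J) :
    opTensor A (c • B) = c • opTensor A B :=
  HilbertTensor.clm_ext fun φ ψ => by
    simp [opTensor_tmul, TensorProduct.tmul_smul, UniformSpace.Completion.coe_smul]

theorem opTensor_mul (A A' : H →L[ℂ] H) (B B' : J →L[ℂ] J) :
    opTensor (A * A') (B * B') = opTensor A B * opTensor A' B' :=
  HilbertTensor.clm_ext fun φ ψ => by
    simp [opTensor_tmul]

theorem norm_opTensor_le (A : H →L[ℂ] H) (B : J →L[ℂ] J) : ‖opTensor A B‖ ≤ ‖A‖ * ‖B‖ := by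
  refine ContinuousLinearMap.opNorm_le_bound _ (by positivity) fun x => ?_
  induction x using UniformSpace.Completion.induction_on with
  | hp => exact isClosed_le (opTensor A B).continuous.norm (continuous_const.mul continuous_norm)
  | ih x =>
    rw [opTensor, ContinuousLinearMap.completion_apply_coe, UniformSpace.Completion.norm_coe,
      UniformSpace.Completion.norm_coe]
    exact ((TensorProduct.mapL A B).le_opNorm x).trans
      (mul_le_mul_of_nonneg_right (TensorProduct.norm_mapL_le A B) (norm_nonneg x))

theorem inner_coe_tmul (φ φ' : H) (ψ ψ' : J) :
    ⟪((φ ⊗ₜ[ℂ] ψ : H ⊗[ℂ] J) : HilbertTensor H J), ((φ' ⊗ₜ[ℂ] ψ' : H ⊗[ℂ] J) : HilbertTensor H J)⟫_ℂ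
      = ⟪φ, φ'⟫_ℂ * ⟪ψ, ψ'⟫_ℂ := by
  rw [UniformSpace.Completion.inner_coe, TensorProduct.inner_tmul]

theorem HasSum.opTensor_left {ι : Type*} {f : ι → H →L[ℂ] H} {A : H →L[ℂ] H} (h : HasSum f A)
    (B : J →L[ℂ] J) : OpHasSum (fun k => opTensor (f k) B) (opTensor A B) :=
  OpHasSum.map h (opTensor · B) (fun A A' => opTensor_add_left A A' B) ‖B‖ fun A =>
    (norm_opTensor_le A B).trans_eq (mul_comm _ _)

theorem HasSum.opTensor_right {ι : Type*} {f : ι → J →L[ℂ] J} {B : J →L[ℂ] J} (A : H →L[ℂ] H)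
    (h : HasSum f B) : OpHasSum (fun k => opTensor A (f k)) (opTensor A B) :=
  OpHasSum.map h (opTensor A ·) (fun B B' => opTensor_add_right A B B') ‖A‖ fun B =>
    norm_opTensor_le A B

theorem enorm_coe_tmul (φ : H) (ψ : J) :
    ‖((φ ⊗ₜ[ℂ] ψ : H ⊗[ℂ] J) : HilbertTensor H J)‖ₑ = ‖φ‖ₑ * ‖ψ‖ₑ := by
  rw [← ofReal_norm, UniformSpace.Completion.norm_coe, TensorProduct.norm_tmul,
    ENNReal.ofReal_mul (norm_nonneg _), ofReal_norm, ofReal_norm]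

/-- The products of the elements of two orthonormal bases form an orthonormal basis of the
Hilbert tensor product. -/
theorem exists_hilbertBasis_tmul {ι κ : Type*} (b : HilbertBasis ι ℂ H) (c : HilbertBasis κ ℂ J) :
    ∃ e : HilbertBasis (ι × κ) ℂ (HilbertTensor H J),
      ∀ p, e p = ((b p.1 ⊗ₜ[ℂ] c p.2 : H ⊗[ℂ] J) : HilbertTensor H J) := by
  let v : ι × κ → HilbertTensor H J := fun p => ((b p.1 ⊗ₜ[ℂ] c p.2 : H ⊗[ℂ] J) : HilbertTensor H J)
  have hv : Orthonormal ℂ v := by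
    classical
    rw [orthonormal_iff_ite]
    rintro ⟨i, j⟩ ⟨i', j'⟩
    simp only [v, inner_coe_tmul, orthonormal_iff_ite.1 b.orthonormal,
      orthonormal_iff_ite.1 c.orthonormal, Prod.mk.injEq, ite_and]
    split_ifs <;> simp
  have hsp : (Submodule.span ℂ (Set.range v))ᗮ = ⊥ := by
    rw [Submodule.eq_bot_iff]
    intro x hx
    have hx' : ∀ i j, ⟪x, v (i, j)⟫_ℂ = 0 := fun i j =>
      Submodule.inner_left_of_mem_orthogonal (Submodule.subset_span (Set.mem_range_self (i, j))) hx
    -- It suffices to test on product vectors; each factor is expanded in its basis, one after the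
    -- other, by continuity in that factor.
    have h0 : innerSL ℂ x = 0 := by
      refine HilbertTensor.clm_ext fun φ ψ => ?_
      rw [zero_apply, innerSL_apply_apply]
      have hφ : ∀ i, ⟪x, ((b i ⊗ₜ[ℂ] ψ : H ⊗[ℂ] J) : HilbertTensor H J)⟫_ℂ = 0 := by
        intro i
        have h1 := (((c.hasSum_repr ψ).mapL (TensorProduct.mkL ℂ H J (b i))).mapL
          (UniformSpace.Completion.toComplL (𝕜 := ℂ))).mapL (innerSL ℂ x)
        refine h1.unique ?_
        convert hasSum_zero with j
        have := hx' i j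
        simp only [v] at this
        simp [this]
      have h1 := (((b.hasSum_repr φ).mapL ((TensorProduct.mkL ℂ H J).flip ψ)).mapL
        (UniformSpace.Completion.toComplL (𝕜 := ℂ))).mapL (innerSL ℂ x)
      refine h1.unique ?_
      convert hasSum_zero with i
      simp [hφ]
    exact innerSL_inj.1 (h0.trans (map_zero _).symm)
  exact ⟨HilbertBasis.mkOfOrthogonalEqBot hv hsp, fun p => by simp [v]⟩

variable [CompleteSpace H] [CompleteSpace J]

theorem star_opTensor (A : H →L[ℂ] H) (B : J →L[ℂ] J) :
    star (opTensor A B) = opTensor (star A) (star B) := by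
  refine HilbertTensor.clm_ext fun φ ψ => ?_
  have : innerSL ℂ (star (opTensor A B) ((φ ⊗ₜ[ℂ] ψ : H ⊗[ℂ] J) : HilbertTensor H J)) =
      innerSL ℂ (opTensor (star A) (star B) ((φ ⊗ₜ[ℂ] ψ : H ⊗[ℂ] J) : HilbertTensor H J)) := by
    refine HilbertTensor.clm_ext fun φ' ψ' => ?_
    simp only [innerSL_apply_apply, ContinuousLinearMap.star_eq_adjoint,
      ContinuousLinearMap.adjoint_inner_left, opTensor_tmul, inner_coe_tmul]
  exact (innerSL_inj (𝕜 := ℂ)).1 this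

theorem opTensor_nonneg {A : H →L[ℂ] H} {B : J →L[ℂ] J} (hA : 0 ≤ A) (hB : 0 ≤ B) :
    0 ≤ opTensor A B := by
  rw [← CFC.sqrt_mul_sqrt_self A hA, ← CFC.sqrt_mul_sqrt_self B hB, opTensor_mul]
  have h : star (opTensor (CFC.sqrt A) (CFC.sqrt B)) = opTensor (CFC.sqrt A) (CFC.sqrt B) := by
    rw [star_opTensor, (CFC.sqrt_nonneg A).isSelfAdjoint.star_eq,
      (CFC.sqrt_nonneg B).isSelfAdjoint.star_eq]
  nth_rw 1 [← h]
  exact ContinuousLinearMap.star_mul_self_nonneg _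

theorem opTensor_abs_mul_self (A : H →L[ℂ] H) (B : J →L[ℂ] J) :
    opTensor (CFC.abs A) (CFC.abs B) * opTensor (CFC.abs A) (CFC.abs B) =
      star (opTensor A B) * opTensor A B := by
  rw [star_opTensor, ← opTensor_mul, ← opTensor_mul, CFC.abs_mul_abs, CFC.abs_mul_abs]

/-- Both sides are positive square roots of `(A ⊗ B)* (A ⊗ B)`. Thus a positive product may be
rewritten with positive factors even if `A` and `B` are not positive. -/
theorem opTensor_abs_eq_of_nonneg {A : H →L[ℂ] H} {B : J →L[ℂ] J} (h : 0 ≤ opTensor A B) :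
    opTensor (CFC.abs A) (CFC.abs B) = opTensor A B :=
  ContinuousLinearMap.eq_of_mul_self_eq
    (opTensor_nonneg (CFC.abs_nonneg A) (CFC.abs_nonneg B)) h (opTensor_abs_mul_self A B)

/-- The trace norm is multiplicative for tensor products. -/
theorem eTraceNorm_opTensor (A : H →L[ℂ] H) (B : J →L[ℂ] J) :
    eTraceNorm (opTensor A B) = eTraceNorm A * eTraceNorm B := by
  have hA := CFC.abs_nonneg A
  have hB := CFC.abs_nonneg B
  obtain ⟨e, he⟩ := exists_hilbertBasis_tmul (onb H) (onb J)
  -- The absolute value is `|A| ⊗ |B|`, with square root `√|A| ⊗ √|B|`; on a product basis the sum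
  -- of squared norms factorises.
  rw [eTraceNorm_eq_tsum_of_mul_self_eq
    (opTensor_nonneg (CFC.sqrt_nonneg (CFC.abs A)) (CFC.sqrt_nonneg (CFC.abs B)))
    (D := opTensor (CFC.abs A) (CFC.abs B))
    (by rw [← opTensor_mul, CFC.sqrt_mul_sqrt_self _ hA, CFC.sqrt_mul_sqrt_self _ hB])
    (opTensor_nonneg hA hB) (opTensor_abs_mul_self A B) e,
    eTraceNorm_eq_tsum_sqrt_abs, eTraceNorm_eq_tsum_sqrt_abs, ENNReal.tsum_prod']
  simp_rw [he, opTensor_tmul, enorm_coe_tmul, mul_pow, ENNReal.tsum_mul_left, ENNReal.tsum_mul_right]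

theorem traceNorm_opTensor (A : H →L[ℂ] H) (B : J →L[ℂ] J) :
    traceNorm (opTensor A B) = traceNorm A * traceNorm B := by
  simp [traceNorm, eTraceNorm_opTensor, ENNReal.toReal_mul]

theorem IsDensityOperator.opTensor {ρ : H →L[ℂ] H} {σ : J →L[ℂ] J} (hρ : IsDensityOperator ρ)
    (hσ : IsDensityOperator σ) : IsDensityOperator (opTensor ρ σ) :=
  isDensityOperator_iff.2 ⟨opTensor_nonneg hρ.nonneg hσ.nonneg, by
    rw [eTraceNorm_opTensor, hρ.eTraceNorm_eq_one, hσ.eTraceNorm_eq_one, one_mul]⟩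

end Tensor

/-! ### Expansion of trace class operators into pure states. -/

section PureStates

/-- Decompositions are indexed by `Type`, whereas bases live in the universe of the Hilbert space.
-/
theorem exists_type_zero_equiv (α : Type*) [Countable α] :
    ∃ (ι : Type) (_ : Countable ι), Nonempty (ι ≃ α) := by
  obtain ⟨f, hf⟩ := exists_injective_nat α
  exact ⟨Set.range f, inferInstance, ⟨(Equiv.ofInjective f hf).symm⟩⟩

variable {K : Type*} [NormedAddCommGroup K] [InnerProductSpace ℂ K] [CompleteSpace K]

/-- Inserting the resolution of the identity between the factors of `P = √P √P` replaces a spectral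
decomposition. -/
theorem hasSum_rankOne_sqrt {P : K →L[ℂ] K} (hP : 0 ≤ P) (ht : IsTraceClass P) :
    HasSum (fun i => ‖CFC.sqrt P (onb K i)‖ ^ 2) (traceNorm P) ∧
      HasSum (fun i => InnerProductSpace.rankOne ℂ (CFC.sqrt P (onb K i)) (CFC.sqrt P (onb K i)))
        P := by
  set T := CFC.sqrt P
  have hTs : star T = T := (CFC.sqrt_nonneg P).isSelfAdjoint
  have hTT : T * T = P := CFC.sqrt_mul_sqrt_self P hP
  have hinner : ∀ x y, ⟪T x, y⟫_ℂ = ⟪x, T y⟫_ℂ := fun x y => by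
    rw [← ContinuousLinearMap.adjoint_inner_right, ← ContinuousLinearMap.star_eq_adjoint, hTs]
  have he : eTraceNorm P = ∑' i, ENNReal.ofReal (‖T (onb K i)‖ ^ 2) := by
    rw [eTraceNorm_eq_tsum_sqrt hP (onb K)]
    simp_rw [ENNReal.ofReal_pow (norm_nonneg _), ofReal_norm]
    rfl
  have hs : Summable fun i => ‖T (onb K i)‖ ^ 2 := by
    have := ENNReal.summable_toReal (he ▸ ht.ne_top)
    simpa [ENNReal.toReal_ofReal] using this
  refine ⟨?_, ?_⟩
  · convert hs.hasSum using 1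
    rw [traceNorm, he, ← ENNReal.ofReal_tsum_of_nonneg (fun _ => by positivity) hs,
      ENNReal.toReal_ofReal (tsum_nonneg fun _ => by positivity)]
  · have hs' : Summable fun i => InnerProductSpace.rankOne ℂ (T (onb K i)) (T (onb K i)) :=
      Summable.of_norm (by simpa [← sq] using hs)
    convert hs'.hasSum using 1
    ext y
    refine ext_inner_left ℂ fun x => ?_
    have h1 := (hs'.hasSum.mapL (ContinuousLinearMap.apply ℂ K y)).mapL (innerSL ℂ x)
    refine HasSum.unique ?_ h1
    have h2 := (onb K).hasSum_inner_mul_inner (T x) (T y)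
    rw [hinner, ← mul_apply_eq_comp, hTT] at h2
    convert h2 using 2 with i
    simp [hinner, mul_comm]

/-- A positive trace class operator is a countable positive combination of pure states. -/
theorem exists_pureState_hasSum_of_nonneg {P : K →L[ℂ] K} (hP : 0 ≤ P) (ht : IsTraceClass P) :
    ∃ (ι : Type) (_ : Countable ι) (a : ι → ℝ) (π : ι → K →L[ℂ] K),
      (∀ k, 0 ≤ a k) ∧ (∀ k, IsPureState (π k)) ∧ HasSum a (traceNorm P) ∧
      HasSum (fun k => (a k : ℂ) • π k) P := by
  obtain ⟨h1, h2⟩ := hasSum_rankOne_sqrt hP ht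
  set T := CFC.sqrt P
  -- The support of a summable family is countable, and on it the vectors can be normalised.
  let s : Set (onbIndex K) := Function.support fun i => ‖T (onb K i)‖ ^ 2
  have : Countable s := h1.summable.countable_support
  obtain ⟨ι, hι, ⟨e⟩⟩ := exists_type_zero_equiv s
  have hne : ∀ k, ‖T (onb K (e k))‖ ≠ 0 := fun k h => (e k).2 (by simp [h])
  have hne' : ∀ k, (‖T (onb K (e k))‖ : ℂ) ≠ 0 := fun k => by exact_mod_cast hne k
  refine ⟨ι, hι, fun k => ‖T (onb K (e k))‖ ^ 2, fun k => InnerProductSpace.rankOne ℂ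
    ((‖T (onb K (e k))‖ : ℂ)⁻¹ • T (onb K (e k))) ((‖T (onb K (e k))‖ : ℂ)⁻¹ • T (onb K (e k))),
    fun k => by positivity, fun k => ⟨_, ?_, rfl⟩, ?_, ?_⟩
  · rw [norm_smul, norm_inv, Complex.norm_real, norm_norm, inv_mul_cancel₀ (hne k)]
  · exact e.hasSum_iff.2 ((hasSum_subtype_iff_of_support_subset subset_rfl).2 h1)
  · have h3 := e.hasSum_iff.2 ((hasSum_subtype_iff_of_support_subset (s := s) (fun i hi => by
      rw [Function.mem_support] at hi ⊢
      contrapose! hi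
      rw [sq_eq_zero_iff, norm_eq_zero] at hi
      rw [hi]; simp)).2 h2)
    convert h3 using 2 with k
    ext x
    have := hne' k
    simp [smul_smul]
    congr 1
    field_simp

theorem eTraceNorm_eq_posPart_add_negPart {X : K →L[ℂ] K} (hX : IsSelfAdjoint X) :
    eTraceNorm X = eTraceNorm X⁺ + eTraceNorm X⁻ := by
  have hp := CFC.posPart_nonneg X
  have hn := CFC.negPart_nonneg X
  rw [eTraceNorm_of_nonneg hp, eTraceNorm_of_nonneg hn, eTraceNorm, ← ENNReal.tsum_add]
  congr! 2 with i
  rw [← ENNReal.ofReal_add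
    (((ContinuousLinearMap.nonneg_iff_isPositive _).1 hp).re_inner_nonneg_right _)
    (((ContinuousLinearMap.nonneg_iff_isPositive _).1 hn).re_inner_nonneg_right _),
    ← map_add, ← inner_add_right, ← add_apply, CFC.posPart_add_negPart X hX]

/-- A selfadjoint trace class operator is a countable real combination of pure states. -/
theorem exists_pureState_hasSum {X : K →L[ℂ] K} (hX : IsSelfAdjoint X) (ht : IsTraceClass X) :
    ∃ (ι : Type) (_ : Countable ι) (a : ι → ℝ) (π : ι → K →L[ℂ] K),
      (∀ k, IsPureState (π k)) ∧ HasSum (fun k => |a k|) (traceNorm X) ∧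
      HasSum (fun k => (a k : ℂ) • π k) X := by
  have hpn := eTraceNorm_eq_posPart_add_negPart hX
  have hp : IsTraceClass X⁺ := lt_of_le_of_lt (hpn ▸ le_self_add) ht
  have hn : IsTraceClass X⁻ := lt_of_le_of_lt (hpn ▸ le_add_self) ht
  obtain ⟨ι, hι, a, π, ha, hπ, hsa, hsπ⟩ :=
    exists_pureState_hasSum_of_nonneg (CFC.posPart_nonneg X) hp
  obtain ⟨κ, hκ, b, ϖ, hb, hϖ, hsb, hsϖ⟩ :=
    exists_pureState_hasSum_of_nonneg (CFC.negPart_nonneg X) hn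
  refine ⟨ι ⊕ κ, inferInstance, Sum.elim a (fun k => - b k), Sum.elim π ϖ, ?_, ?_, ?_⟩
  · rintro (k | k)
    exacts [hπ k, hϖ k]
  · have : traceNorm X = traceNorm X⁺ + traceNorm X⁻ := by
      rw [traceNorm, hpn, ENNReal.toReal_add hp.ne_top hn.ne_top, traceNorm, traceNorm]
    rw [this]
    refine HasSum.sum ?_ ?_
    · simpa [Function.comp_def, abs_of_nonneg (ha _)] using hsa
    · simpa [Function.comp_def, abs_of_nonneg (hb _)] using hsb
  · rw [← CFC.posPart_sub_negPart X hX, sub_eq_add_neg]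
    refine HasSum.sum ?_ ?_
    · simpa [Function.comp_def] using hsπ
    · simpa [Function.comp_def] using hsϖ.neg

/-- Tonelli for the coefficients; the total is computed exactly, as preserving infima and optimality
requires. -/
theorem hasSum_sigma_prod_of_nonneg {κ : Type*} {ι₁ ι₂ : κ → Type*} {r : κ → ℝ}
    {a : ∀ k, ι₁ k → ℝ} {b : ∀ k, ι₂ k → ℝ} {A B : κ → ℝ} {c : ℝ} (hr : ∀ k, 0 ≤ r k)
    (ha : ∀ k i, 0 ≤ a k i) (hb : ∀ k j, 0 ≤ b k j)
    (hA : ∀ k, HasSum (a k) (A k)) (hB : ∀ k, HasSum (b k) (B k))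
    (h₀ : HasSum (fun k => r k * (A k * B k)) c) :
    HasSum (fun p : Σ k, ι₁ k × ι₂ k => r p.1 * (a p.1 p.2.1 * b p.1 p.2.2)) c := by
  have hk : ∀ k, HasSum (fun p : ι₁ k × ι₂ k => r k * (a k p.1 * b k p.2)) (r k * (A k * B k)) :=
    fun k => ((hA k).mul (hB k) ((hA k).summable.mul_of_nonneg (hB k).summable
      (ha k) (hb k))).mul_left (r k)
  refine HasSum.sigma_of_hasSum h₀ hk ((summable_sigma_of_nonneg fun p =>
    mul_nonneg (hr _) (mul_nonneg (ha _ _) (hb _ _))).2 ⟨fun k => (hk k).summable, ?_⟩)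
  simp_rw [fun k => (hk k).tsum_eq]
  exact h₀.summable

end PureStates

/-! ### Normalisation and Cartesian decomposition of operators. -/

section Operators

variable {K : Type*} [NormedAddCommGroup K] [InnerProductSpace ℂ K] [CompleteSpace K]

theorem IsDensityOperator.eTraceNorm_smul {ρ : K →L[ℂ] K} (h : IsDensityOperator ρ) (t : ℝ) :
    eTraceNorm ((t : ℂ) • ρ) = ENNReal.ofReal |t| := by
  rw [_root_.eTraceNorm_smul, h.eTraceNorm_eq_one, mul_one, ← ofReal_norm, Complex.norm_real,
    Real.norm_eq_abs]

theorem IsDensityOperator.isSelfAdjoint {ρ : K →L[ℂ] K} (h : IsDensityOperator ρ) :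
    IsSelfAdjoint ρ :=
  h.positive.isSelfAdjoint

theorem IsDensityOperator.smul_nonneg {ρ : K →L[ℂ] K} (h : IsDensityOperator ρ) {t : ℝ}
    (ht : 0 ≤ t) : 0 ≤ (t : ℂ) • ρ := by
  rw [Complex.coe_smul]
  exact _root_.smul_nonneg ht h.nonneg

theorem isDensityOperator_abs_smul {X : K →L[ℂ] K} (hX : IsTraceClass X) (h : traceNorm X ≠ 0) :
    IsDensityOperator (((traceNorm X)⁻¹ : ℝ) • CFC.abs X) := by
  refine isDensityOperator_iff.2 ⟨smul_nonneg (inv_nonneg.2 (traceNorm_nonneg X))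
    (CFC.abs_nonneg X), ?_⟩
  have h1 : eTraceNorm (CFC.abs X) = eTraceNorm X := by
    rw [eTraceNorm_of_nonneg (CFC.abs_nonneg X), eTraceNorm]
  rw [← Complex.coe_smul, _root_.eTraceNorm_smul, h1, ← ofReal_norm, Complex.norm_real,
    Real.norm_of_nonneg (inv_nonneg.2 (traceNorm_nonneg X)), ← hX.ofReal_traceNorm,
    ← ENNReal.ofReal_mul (inv_nonneg.2 (traceNorm_nonneg X)), inv_mul_cancel₀ h, ENNReal.ofReal_one]

theorem IsSelfAdjoint.ofReal_smul {A : K →L[ℂ] K} (hA : IsSelfAdjoint A) (t : ℝ) :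
    IsSelfAdjoint ((t : ℂ) • A) := by
  rw [IsSelfAdjoint, star_smul, hA.star_eq, Complex.star_def, Complex.conj_ofReal]

theorem traceNorm_add_le {S T : K →L[ℂ] K} (hS : IsTraceClass S) (hT : IsTraceClass T) :
    traceNorm (S + T) ≤ traceNorm S + traceNorm T := by
  rw [traceNorm, traceNorm, traceNorm, ← ENNReal.toReal_add hS.ne_top hT.ne_top]
  exact ENNReal.toReal_mono (ENNReal.add_ne_top.2 ⟨hS.ne_top, hT.ne_top⟩) (eTraceNorm_add_le S T)

/-- The Cartesian decomposition of a trace class operator. -/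
theorem IsTraceClass.exists_cartesian {X : K →L[ℂ] K} (hX : IsTraceClass X) :
    ∃ A B : K →L[ℂ] K, IsSelfAdjoint A ∧ IsSelfAdjoint B ∧ X = A + Complex.I • B ∧
      IsTraceClass A ∧ IsTraceClass B ∧ traceNorm A ≤ traceNorm X ∧ traceNorm B ≤ traceNorm X := by
  have hs := isTraceClass_star hX
  have hns : traceNorm (star X) = traceNorm X := by rw [traceNorm, eTraceNorm_star, traceNorm]
  have hm : traceNorm ((-1 : ℂ) • star X) = traceNorm X := by rw [traceNorm_smul, hns]; simp
  refine ⟨(2⁻¹ : ℂ) • (X + star X), (-(Complex.I / 2)) • (X + (-1 : ℂ) • star X), ?_, ?_, ?_,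
    (hX.add hs).smul _, (hX.add (hs.smul _)).smul _, ?_, ?_⟩
  · rw [IsSelfAdjoint, star_smul, star_add, star_star, add_comm]
    simp
  · rw [IsSelfAdjoint, star_smul, star_add, star_smul, star_star]
    simp only [Complex.star_def, map_neg, map_div₀, Complex.conj_I, map_one, map_ofNat]
    module
  · rw [smul_smul, mul_neg, ← mul_div_assoc, Complex.I_mul_I]
    module
  · rw [traceNorm_smul]
    have := traceNorm_add_le hX hs
    rw [hns] at this
    norm_num
    linarith
  · rw [traceNorm_smul]
    have := traceNorm_add_le hX (hs.smul (-1))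
    rw [hm] at this
    rw [norm_neg, norm_div, Complex.norm_I]
    norm_num at this ⊢
    linarith

end Operators

/-! ### Cartesian decomposition of product operators. -/

section Cartesian

variable {H J : Type*} [NormedAddCommGroup H] [InnerProductSpace ℂ H]
  [NormedAddCommGroup J] [InnerProductSpace ℂ J]

/-- The mixed terms carry `±i` and cancel. For selfadjoint `A, B, D, E` the left side is a product
plus its adjoint. -/
theorem opTensor_cartesian (A B : H →L[ℂ] H) (D E : J →L[ℂ] J) :
    opTensor (A + Complex.I • B) (D + Complex.I • E) +
      opTensor (A + (starRingEnd ℂ) Complex.I • B) (D + (starRingEnd ℂ) Complex.I • E) =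
      (2 : ℂ) • (opTensor A D + (-1 : ℂ) • opTensor B E) := by
  simp only [opTensor_add_left, opTensor_add_right, opTensor_smul_left, opTensor_smul_right,
    Complex.conj_I, smul_add, smul_smul, neg_mul_neg, Complex.I_mul_I]
  module

end Cartesian

/-! ### From standard decompositions to pure signed ones. -/

section Decompositions

variable {H J : Type*}
  [NormedAddCommGroup H] [InnerProductSpace ℂ H] [CompleteSpace H]
  [NormedAddCommGroup J] [InnerProductSpace ℂ J] [CompleteSpace J]
  {ι : Type} {C : HilbertTensor H J →L[ℂ] HilbertTensor H J}

theorem tsum_eTraceNorm_ne_top {t : ι → ℝ} {ρ : ι → H →L[ℂ] H} {σ : ι → J →L[ℂ] J}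
    (ht : Summable fun k => |t k|) (hρ : ∀ k, IsDensityOperator (ρ k))
    (hσ : ∀ k, IsDensityOperator (σ k)) :
    ∑' k, eTraceNorm ((t k : ℂ) • opTensor (ρ k) (σ k)) ≠ ⊤ := by
  simp_rw [fun k => ((hρ k).opTensor (hσ k)).eTraceNorm_smul]
  exact ht.tsum_ofReal_ne_top

theorem isSignedDecomposition_iff {t : ι → ℝ} {ρ : ι → H →L[ℂ] H} {σ : ι → J →L[ℂ] J}
    (ht : Summable fun k => |t k|) (hρ : ∀ k, IsDensityOperator (ρ k))
    (hσ : ∀ k, IsDensityOperator (σ k)) :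
    IsSignedDecomposition C t ρ σ ↔ OpHasSum (fun k => (t k : ℂ) • opTensor (ρ k) (σ k)) C :=
  ⟨fun h => h.hasSum.opHasSum, fun h => ⟨ht, hρ, hσ, h.hasSumIn (tsum_eTraceNorm_ne_top ht hρ hσ)⟩⟩

theorem tsum_eTraceNorm_smul_opTensor_ne_top {s : ι → ℝ} {X : ι → H →L[ℂ] H} {Y : ι → J →L[ℂ] J}
    (hX : ∀ k, IsTraceClass (X k)) (hY : ∀ k, IsTraceClass (Y k))
    (hs : Summable fun k => |s k| * (traceNorm (X k) * traceNorm (Y k))) :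
    ∑' k, eTraceNorm ((s k : ℂ) • opTensor (X k) (Y k)) ≠ ⊤ := by
  convert hs.tsum_ofReal_ne_top using 3 with k
  rw [eTraceNorm_smul, eTraceNorm_opTensor, ENNReal.ofReal_mul (abs_nonneg _),
      ENNReal.ofReal_mul (traceNorm_nonneg _), (hX k).ofReal_traceNorm, (hY k).ofReal_traceNorm,
      ← ofReal_norm, Complex.norm_real, Real.norm_eq_abs]

/-- Expansion of selfadjoint factors into pure states. -/
theorem exists_pureSignedDecomposition {κ : Type} [Countable κ] {s : κ → ℝ}
    {X : κ → H →L[ℂ] H} {Y : κ → J →L[ℂ] J} (hX : ∀ k, IsSelfAdjoint (X k))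
    (hY : ∀ k, IsSelfAdjoint (Y k)) (hXt : ∀ k, IsTraceClass (X k)) (hYt : ∀ k, IsTraceClass (Y k))
    {c : ℝ} (hs : HasSum (fun k => |s k| * (traceNorm (X k) * traceNorm (Y k))) c)
    (hC : OpHasSum (fun k => (s k : ℂ) • opTensor (X k) (Y k)) C) :
    ∃ (ι : Type) (_ : Countable ι) (t : ι → ℝ) (π : ι → H →L[ℂ] H) (ϖ : ι → J →L[ℂ] J),
      IsPureSignedDecomposition C t π ϖ ∧ ∑' k, |t k| = c := by
  choose ι₁ _ a π hπ ha haπ using fun k => exists_pureState_hasSum (hX k) (hXt k)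
  choose ι₂ _ b ϖ hϖ hb hbϖ using fun k => exists_pureState_hasSum (hY k) (hYt k)
  let t : (Σ k, ι₁ k × ι₂ k) → ℝ := fun p => s p.1 * (a p.1 p.2.1 * b p.1 p.2.2)
  have ht : HasSum (fun p => |t p|) c := by
    have := hasSum_sigma_prod_of_nonneg (r := fun k => |s k|) (a := fun k i => |a k i|)
      (b := fun k j => |b k j|) (fun _ => abs_nonneg _) (fun _ _ => abs_nonneg _)
      (fun _ _ => abs_nonneg _) ha hb hs
    simpa only [t, abs_mul] using this
  have hπ' := fun p : Σ k, ι₁ k × ι₂ k => (hπ p.1 p.2.1).isDensityOperator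
  have hϖ' := fun p : Σ k, ι₁ k × ι₂ k => (hϖ p.1 p.2.2).isDensityOperator
  refine ⟨Σ k, ι₁ k × ι₂ k, inferInstance, t, fun p => π p.1 p.2.1, fun p => ϖ p.1 p.2.2,
    ⟨(isSignedDecomposition_iff ht.summable hπ' hϖ').2 ?_, fun p => hπ _ _,
      fun p => hϖ _ _⟩, ht.tsum_eq⟩
  -- In the intermediate sums only the left factor is expanded, so each stage uses continuity of the
  -- product in a single variable.
  refine opHasSum_sigma_prod (g₁ := fun k i => ((s k * a k i : ℝ) : ℂ) • opTensor (π k i) (Y k))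
    (g₀ := fun k => (s k : ℂ) • opTensor (X k) (Y k))
    (tsum_eTraceNorm_ne_top ht.summable hπ' hϖ') (fun k i => ?_) (fun k => ?_) hC
  · refine ((HasSum.opTensor_right (π k i) (hbϖ k)).const_smul ((s k * a k i : ℝ) : ℂ)).congr
      (fun j => ?_) rfl
    rw [opTensor_smul_right, smul_smul]
    congr 1
    simp only [t]
    push_cast
    ring
  · refine (((haπ k).opTensor_left (Y k)).const_smul (s k : ℂ)).congr (fun i => ?_) rfl
    rw [opTensor_smul_left, smul_smul]
    congr 1
    push_cast
    ring

section StandardDecomposition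

variable {r : ι → ℝ} {X : ι → H →L[ℂ] H} {Y : ι → J →L[ℂ] J}

theorem IsStandardDecomposition.eTraceNorm_term (h : IsStandardDecomposition C r X Y) (k : ι) :
    eTraceNorm ((r k : ℂ) • opTensor (X k) (Y k)) = ENNReal.ofReal (r k) := by
  rw [eTraceNorm_smul, eTraceNorm_opTensor, ← (h.traceClass_left k).ofReal_traceNorm,
    ← (h.traceClass_right k).ofReal_traceNorm, ← ENNReal.ofReal_mul (traceNorm_nonneg _),
    h.norm_eq_one, ENNReal.ofReal_one, mul_one, ← ofReal_norm, Complex.norm_real,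
    Real.norm_of_nonneg (h.nonneg k)]

theorem IsStandardDecomposition.tsum_eTraceNorm (h : IsStandardDecomposition C r X Y) :
    ∑' k, eTraceNorm ((r k : ℂ) • opTensor (X k) (Y k)) = ENNReal.ofReal (∑' k, r k) := by
  simp_rw [h.eTraceNorm_term, ENNReal.ofReal_tsum_of_nonneg h.nonneg h.summable]

theorem IsStandardDecomposition.eTraceNorm_le (h : IsStandardDecomposition C r X Y) :
    eTraceNorm C ≤ ENNReal.ofReal (∑' k, r k) :=
  h.tsum_eTraceNorm ▸ h.hasSum.opHasSum.eTraceNorm_le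

theorem IsStandardDecomposition.eProjNorm_le [Countable ι] (h : IsStandardDecomposition C r X Y) :
    eProjNorm C ≤ ENNReal.ofReal (∑' k, r k) :=
  sInf_le ⟨ι, inferInstance, r, X, Y, h, rfl⟩

theorem IsHermitianStandardDecomposition.eHermProjNorm_le [Countable ι]
    (h : IsHermitianStandardDecomposition C r X Y) :
    eHermProjNorm C ≤ ENNReal.ofReal (∑' k, r k) :=
  sInf_le ⟨ι, inferInstance, r, X, Y, h, rfl⟩

theorem eTraceNorm_le_eProjNorm (C : HilbertTensor H J →L[ℂ] HilbertTensor H J) :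
    eTraceNorm C ≤ eProjNorm C := by
  refine le_sInf ?_
  rintro _ ⟨ι, _, r, X, Y, h, rfl⟩
  exact h.eTraceNorm_le

theorem eProjNorm_le_eHermProjNorm (C : HilbertTensor H J →L[ℂ] HilbertTensor H J) :
    eProjNorm C ≤ eHermProjNorm C := by
  refine le_sInf ?_
  rintro _ ⟨ι, _, r, X, Y, h, rfl⟩
  exact h.toIsStandardDecomposition.eProjNorm_le

theorem IsHermitianStandardDecomposition.norm_chain [Countable ι]
    (h : IsHermitianStandardDecomposition C r X Y) :
    traceNorm C ≤ projNorm C ∧ projNorm C ≤ hermProjNorm C ∧ hermProjNorm C ≤ ∑' k, r k := by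
  have h1 : eHermProjNorm C ≠ ⊤ := (h.eHermProjNorm_le.trans_lt ENNReal.ofReal_lt_top).ne
  have h2 : eProjNorm C ≠ ⊤ := ((eProjNorm_le_eHermProjNorm C).trans_lt h1.lt_top).ne
  exact ⟨ENNReal.toReal_mono h2 (eTraceNorm_le_eProjNorm C),
    ENNReal.toReal_mono h1 (eProjNorm_le_eHermProjNorm C),
    ENNReal.toReal_le_of_le_ofReal (tsum_nonneg h.nonneg) h.eHermProjNorm_le⟩

theorem IsHermitianStandardDecomposition.exists_pure [Countable ι]
    (h : IsHermitianStandardDecomposition C r X Y) :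
    ∃ (κ : Type) (_ : Countable κ) (t : κ → ℝ) (π : κ → H →L[ℂ] H) (ϖ : κ → J →L[ℂ] J),
      IsPureSignedDecomposition C t π ϖ ∧ ∑' k, |t k| = ∑' k, r k := by
  refine exists_pureSignedDecomposition h.selfAdjoint_left h.selfAdjoint_right h.traceClass_left
    h.traceClass_right ?_ h.hasSum.opHasSum
  simpa only [h.norm_eq_one, mul_one, abs_of_nonneg (h.nonneg _)] using h.summable.hasSum

/-- A selfadjoint `C` is the mean of its series and the adjoint series. With `X = A + iB` and `Y = D
+ iE` the mean has terms `r (A ⊗ D) - r (B ⊗ E)`. Summability survives, but the total may grow. -/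
theorem IsStandardDecomposition.exists_pure [Countable ι] (h : IsStandardDecomposition C r X Y)
    (hC : IsSelfAdjoint C) :
    ∃ (κ : Type) (_ : Countable κ) (t : κ → ℝ) (π : κ → H →L[ℂ] H) (ϖ : κ → J →L[ℂ] J),
      IsPureSignedDecomposition C t π ϖ := by
  choose A B hA hB hXAB hAt hBt hAn hBn using fun k => (h.traceClass_left k).exists_cartesian
  choose D E hD hE hYDE hDt hEt hDn hEn using fun k => (h.traceClass_right k).exists_cartesian
  have hle : ∀ (F : ι → H →L[ℂ] H) (G : ι → J →L[ℂ] J),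
      (∀ k, traceNorm (F k) ≤ traceNorm (X k)) → (∀ k, traceNorm (G k) ≤ traceNorm (Y k)) →
      Summable fun k => |r k| * (traceNorm (F k) * traceNorm (G k)) := fun F G hF hG => by
    refine Summable.of_nonneg_of_le (fun k => mul_nonneg (abs_nonneg _)
      (mul_nonneg (traceNorm_nonneg _) (traceNorm_nonneg _))) (fun k => ?_) h.summable
    rw [abs_of_nonneg (h.nonneg k)]
    refine mul_le_of_le_one_right (h.nonneg k) ?_
    rw [← h.norm_eq_one k]
    exact mul_le_mul (hF k) (hG k) (traceNorm_nonneg _) (traceNorm_nonneg _)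
  have hCC : OpHasSum (Sum.elim (fun k => (r k : ℂ) • opTensor (A k) (D k))
      fun k => ((-r k : ℝ) : ℂ) • opTensor (B k) (E k)) C := by
    obtain ⟨S, hS⟩ := exists_opHasSum (tsum_eTraceNorm_smul_opTensor_ne_top hAt hDt (hle A D hAn hDn))
    obtain ⟨T, hT⟩ := exists_opHasSum (tsum_eTraceNorm_smul_opTensor_ne_top (s := fun k => -r k)
      hBt hEt (by simpa only [abs_neg] using hle B E hBn hEn))
    have h1 := (h.hasSum.opHasSum.add h.hasSum.opHasSum.star).const_smul 2⁻¹
    rw [hC.star_eq] at h1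
    have h2 : (2⁻¹ : ℂ) • (C + C) = S + T := h1.unique ((hS.add hT).congr (fun k => ?_) rfl)
    · exact (hS.sumElim hT).congr (fun _ => rfl) (by rw [← h2]; module)
    · rw [star_smul, star_opTensor, hXAB, hYDE, star_add, star_add, star_smul, star_smul,
        (hA k).star_eq, (hB k).star_eq, (hD k).star_eq, (hE k).star_eq,
        Complex.star_def, Complex.conj_ofReal, ← smul_add, opTensor_cartesian, Complex.ofReal_neg]
      module
  have hs : Summable fun k : ι ⊕ ι => |Sum.elim r (fun k => -r k) k| *
      (traceNorm (Sum.elim A B k) * traceNorm (Sum.elim D E k)) :=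
    Summable.sum _ (hle A D hAn hDn) (by
      simpa only [Function.comp_def, Sum.elim_inr, abs_neg] using hle B E hBn hEn)
  obtain ⟨κ, hκ, t, π, ϖ, hd, -⟩ := exists_pureSignedDecomposition
    (s := Sum.elim r fun k => -r k) (X := Sum.elim A B) (Y := Sum.elim D E)
    (by rintro (k | k); exacts [hA k, hB k]) (by rintro (k | k); exacts [hD k, hE k])
    (by rintro (k | k); exacts [hAt k, hBt k]) (by rintro (k | k); exacts [hDt k, hEt k])
    hs.hasSum (hCC.congr (by rintro (k | k) <;> rfl) rfl)
  exact ⟨κ, hκ, t, π, ϖ, hd⟩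

end StandardDecomposition

end Decompositions

/-! ### Signed decompositions: trace, norms, optimality and convergence. -/

section SignedDecompositions

variable {H J : Type*}
  [NormedAddCommGroup H] [InnerProductSpace ℂ H] [CompleteSpace H]
  [NormedAddCommGroup J] [InnerProductSpace ℂ J] [CompleteSpace J]
  {ι : Type} {C : HilbertTensor H J →L[ℂ] HilbertTensor H J}

section Basic

variable {t : ι → ℝ} {ρ : ι → H →L[ℂ] H} {σ : ι → J →L[ℂ] J}

/-- The sign at `t k = 0` is taken to be `1` rather than `0`, so that the product of trace norms is
one for every index. -/
theorem IsSignedDecomposition.hermitian (h : IsSignedDecomposition C t ρ σ) :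
    IsHermitianStandardDecomposition C (fun k => |t k|)
      (fun k => ((if 0 ≤ t k then 1 else -1 : ℝ) : ℂ) • ρ k) σ where
  nonneg _ := abs_nonneg _
  summable := h.summable
  traceClass_left k := (h.density_left k).traceClass.smul _
  traceClass_right k := (h.density_right k).traceClass
  norm_eq_one k := by
    rw [traceNorm_smul, (h.density_left k).traceNorm_eq_one, (h.density_right k).traceNorm_eq_one]
    split_ifs <;> simp
  hasSum := by
    convert h.hasSum using 2 with k
    rw [opTensor_smul_left, smul_smul, ← Complex.ofReal_mul]
    congr 2
    split_ifs with hk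
    · rw [abs_of_nonneg hk, mul_one]
    · rw [abs_of_neg (not_le.1 hk)]; ring
  selfAdjoint_left k := (h.density_left k).isSelfAdjoint.ofReal_smul _
  selfAdjoint_right k := (h.density_right k).isSelfAdjoint

theorem IsSignedDecomposition.tsum_ne_top (h : IsSignedDecomposition C t ρ σ) :
    ∑' k, eTraceNorm ((t k : ℂ) • opTensor (ρ k) (σ k)) ≠ ⊤ :=
  tsum_eTraceNorm_ne_top h.summable h.density_left h.density_right

theorem IsSignedDecomposition.opTrace_eq (h : IsSignedDecomposition C t ρ σ) :
    opTrace C = ((∑' k, t k : ℝ) : ℂ) := by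
  rw [← (h.hasSum.opHasSum.hasSum_opTrace h.tsum_ne_top).tsum_eq, Complex.ofReal_tsum]
  congr 1
  ext k
  rw [opTrace_smul, ((h.density_left k).opTensor (h.density_right k)).trace_eq_one, mul_one]

theorem IsSignedDecomposition.isTraceClass (h : IsSignedDecomposition C t ρ σ) :
    IsTraceClass C :=
  h.hasSum.opHasSum.eTraceNorm_le.trans_lt h.tsum_ne_top.lt_top

theorem IsSignedDecomposition.isSelfAdjoint (h : IsSignedDecomposition C t ρ σ) :
    IsSelfAdjoint C :=
  h.hasSum.opHasSum.isSelfAdjoint fun k =>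
    ((h.density_left k).opTensor (h.density_right k)).isSelfAdjoint.ofReal_smul _

theorem IsSignedDecomposition.isSelfAdjointCrossTraceClass [Countable ι]
    (h : IsSignedDecomposition C t ρ σ) : IsSelfAdjointCrossTraceClass C :=
  ⟨⟨h.isTraceClass, ι, inferInstance, _, _, _, h.hermitian.toIsStandardDecomposition⟩,
    h.isSelfAdjoint⟩

theorem IsSignedDecomposition.norm_chain [Countable ι] (h : IsSignedDecomposition C t ρ σ) :
    traceNorm C ≤ projNorm C ∧ projNorm C ≤ hermProjNorm C ∧ hermProjNorm C ≤ ∑' k, |t k| :=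
  h.hermitian.norm_chain

/-- The chain of norms lies between `|tr C| = |∑ t|` and `∑ |t|`, so it collapses when these agree.
-/
theorem IsSignedDecomposition.tsum_abs_eq [Countable ι] (h : IsSignedDecomposition C t ρ σ)
    (ht : |∑' k, t k| = ∑' k, |t k|) :
    traceNorm C = ∑' k, |t k| ∧ projNorm C = ∑' k, |t k| ∧ hermProjNorm C = ∑' k, |t k| := by
  obtain ⟨h1, h2, h3⟩ := h.norm_chain
  have h4 := h.isTraceClass.norm_opTrace_le
  rw [h.opTrace_eq, Complex.norm_real, Real.norm_eq_abs, ht] at h4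
  refine ⟨?_, ?_, ?_⟩ <;> linarith

theorem IsSignedDecomposition.hermNormOptimallyDecomposable [Countable ι]
    (h : IsSignedDecomposition C t ρ σ) (ht : |∑' k, t k| = ∑' k, |t k|) :
    HermNormOptimallyDecomposable C :=
  ⟨ι, inferInstance, _, _, _, h.hermitian, (h.tsum_abs_eq ht).2.2⟩

theorem IsSignedDecomposition.exists_pos_and_exists_neg [Countable ι]
    (h : IsSignedDecomposition C t ρ σ) (hC : ¬ HermNormOptimallyDecomposable C) :
    (∃ k, 0 < t k) ∧ ∃ k, t k < 0 := by
  constructor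
  · by_contra! hk
    refine hC (h.hermNormOptimallyDecomposable ?_)
    simp_rw [fun k => abs_of_nonpos (hk k)]
    rw [tsum_neg, abs_of_nonpos (tsum_nonpos hk)]
  · by_contra! hk
    refine hC (h.hermNormOptimallyDecomposable ?_)
    simp_rw [fun k => abs_of_nonneg (hk k)]
    rw [abs_of_nonneg (tsum_nonneg hk)]

theorem IsPositiveDecomposition.isPositive (h : IsPositiveDecomposition C t ρ σ) :
    C.IsPositive :=
  (ContinuousLinearMap.nonneg_iff_isPositive C).1 <| h.hasSum.opHasSum.nonneg fun k =>
    ((h.density_left k).opTensor (h.density_right k)).smul_nonneg (h.nonneg k)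

theorem IsPositiveDecomposition.isHermitianStandardDecomposition
    (h : IsPositiveDecomposition C t ρ σ) : IsHermitianStandardDecomposition C t ρ σ := by
  have := h.hermitian
  simpa only [abs_of_nonneg (h.nonneg _), if_pos (h.nonneg _), Complex.ofReal_one, one_smul]
    using this

theorem IsPositiveDecomposition.norms_eq [Countable ι] (h : IsPositiveDecomposition C t ρ σ) :
    traceNorm C = ∑' k, t k ∧ projNorm C = ∑' k, t k ∧ hermProjNorm C = ∑' k, t k := by
  have h1 : ∑' k, |t k| = ∑' k, t k := by simp_rw [fun k => abs_of_nonneg (h.nonneg k)]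
  have := h.tsum_abs_eq (by rw [h1, abs_of_nonneg (tsum_nonneg h.nonneg)])
  rwa [h1] at this

end Basic

theorem IsSelfAdjointCrossTraceClass.exists_pure (hC : IsSelfAdjointCrossTraceClass C) :
    ∃ (κ : Type) (_ : Countable κ) (t : κ → ℝ) (π : κ → H →L[ℂ] H) (ϖ : κ → J →L[ℂ] J),
      IsPureSignedDecomposition C t π ϖ := by
  obtain ⟨⟨-, ι, _, r, X, Y, h⟩, hs⟩ := hC
  exact h.exists_pure hs

/-- A standard decomposition of a positive operator in which the sum of the coefficients is the
trace norm yields a positive decomposition. -/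
theorem IsStandardDecomposition.exists_isPositiveDecomposition {r : ι → ℝ} {X : ι → H →L[ℂ] H}
    {Y : ι → J →L[ℂ] J} (h : IsStandardDecomposition C r X Y) (hC : C.IsPositive)
    (hr : ∑' k, r k = traceNorm C) :
    ∃ (ρ : ι → H →L[ℂ] H) (σ : ι → J →L[ℂ] J), IsPositiveDecomposition C r ρ σ := by
  have hfin : ∑' k, eTraceNorm ((r k : ℂ) • opTensor (X k) (Y k)) ≠ ⊤ := by
    rw [h.tsum_eTraceNorm]; exact ENNReal.ofReal_ne_top
  have htr := h.hasSum.opHasSum.hasSum_opTrace hfin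
  rw [opTrace_of_nonneg ((ContinuousLinearMap.nonneg_iff_isPositive C).2 hC), ← hr] at htr
  -- Equality case: the defects `r k (1 - re tr)` are nonnegative because `|tr| ≤ 1`, and they sum
  -- to zero, so each vanishes.
  have htr' : HasSum (fun k => r k - (r k * opTrace (opTensor (X k) (Y k))).re) 0 := by
    have h1 := h.summable.hasSum.sub (Complex.hasSum_re htr)
    rw [Complex.ofReal_re, sub_self] at h1
    simpa only [opTrace_smul] using h1
  have htc : ∀ k, IsTraceClass (opTensor (X k) (Y k)) := fun k => by
    rw [IsTraceClass, eTraceNorm_opTensor]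
    exact ENNReal.mul_lt_top (h.traceClass_left k) (h.traceClass_right k)
  have hnorm : ∀ k, ‖opTrace (opTensor (X k) (Y k))‖ ≤ 1 := fun k => by
    rw [← h.norm_eq_one k, ← traceNorm_opTensor]
    exact (htc k).norm_opTrace_le
  have hterm : ∀ k, (r k * opTrace (opTensor (X k) (Y k))).re =
      r k * (opTrace (opTensor (X k) (Y k))).re := fun k => Complex.re_ofReal_mul _ _
  have hnn : ∀ k, 0 ≤ r k - (r k * opTrace (opTensor (X k) (Y k))).re := fun k => by
    rw [hterm, sub_nonneg]
    exact mul_le_of_le_one_right (h.nonneg k) ((Complex.re_le_norm _).trans (hnorm k))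
  have hzero := (hasSum_zero_iff_of_nonneg hnn).1 htr'
  have hpos : ∀ k, r k ≠ 0 → 0 ≤ opTensor (X k) (Y k) := fun k hk => by
    have h1 := congrFun hzero k
    simp only [Pi.zero_apply, hterm] at h1
    have h2 : (opTrace (opTensor (X k) (Y k))).re = 1 := by
      have : r k * (1 - (opTrace (opTensor (X k) (Y k))).re) = 0 := by linarith
      rcases mul_eq_zero.1 this with h3 | h3
      · exact absurd h3 hk
      · linarith
    refine (htc k).nonneg_of_opTrace_eq ?_
    rw [traceNorm_opTensor, h.norm_eq_one]
    have h4 := hnorm k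
    have h5 := Complex.sq_norm (opTrace (opTensor (X k) (Y k)))
    rw [Complex.normSq_apply, h2] at h5
    refine Complex.ext (by simpa using h2) ?_
    have : (opTrace (opTensor (X k) (Y k))).im ^ 2 ≤ 0 := by
      nlinarith [norm_nonneg (opTrace (opTensor (X k) (Y k)))]
    simpa using pow_eq_zero_iff two_ne_zero |>.1 (le_antisymm this (sq_nonneg _))
  have hX0 : ∀ k, traceNorm (X k) ≠ 0 := fun k => left_ne_zero_of_mul_eq_one (h.norm_eq_one k)
  have hY0 : ∀ k, traceNorm (Y k) ≠ 0 := fun k => right_ne_zero_of_mul_eq_one (h.norm_eq_one k)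
  have hρ := fun k => isDensityOperator_abs_smul (h.traceClass_left k) (hX0 k)
  have hσ := fun k => isDensityOperator_abs_smul (h.traceClass_right k) (hY0 k)
  refine ⟨_, _, (isSignedDecomposition_iff (by
    simpa only [abs_of_nonneg (h.nonneg _)] using h.summable) hρ hσ).2
      (h.hasSum.opHasSum.congr (fun k => ?_) rfl), h.nonneg⟩
  -- Positivity of the product is known only for a nonzero coefficient; otherwise the term vanishes
  -- whatever the states.
  rcases eq_or_ne (r k) 0 with hk | hk
  · rw [hk, Complex.ofReal_zero, zero_smul, zero_smul]
  · rw [← Complex.coe_smul, ← Complex.coe_smul, opTensor_smul_left, opTensor_smul_right,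
      opTensor_abs_eq_of_nonneg (hpos k hk), smul_smul (((traceNorm (X k))⁻¹ : ℝ) : ℂ),
      ← Complex.ofReal_mul, ← mul_inv, h.norm_eq_one, inv_one, Complex.ofReal_one, one_smul]

/-- The given decomposition makes the extended infimum finite, so nothing is lost in `toReal`. -/
theorem isGLB_hermProjNorm {κ : Type} [Countable κ] {r : κ → ℝ} {X : κ → H →L[ℂ] H}
    {Y : κ → J →L[ℂ] J} (h : IsHermitianStandardDecomposition C r X Y) :
    IsGLB {s : ℝ | ∃ (ι : Type) (_ : Countable ι) (r : ι → ℝ) (X : ι → H →L[ℂ] H)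
      (Y : ι → J →L[ℂ] J), IsHermitianStandardDecomposition C r X Y ∧ s = ∑' k, r k}
      (hermProjNorm C) := by
  constructor
  · rintro _ ⟨ι, _, r, X, Y, h, rfl⟩
    exact h.norm_chain.2.2
  · intro b hb
    rw [hermProjNorm, ← ENNReal.ofReal_le_iff_le_toReal
      (h.eHermProjNorm_le.trans_lt ENNReal.ofReal_lt_top).ne]
    refine le_sInf ?_
    rintro _ ⟨ι, _, r, X, Y, h, rfl⟩
    exact ENNReal.ofReal_le_ofReal (hb ⟨ι, inferInstance, r, X, Y, h, rfl⟩)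

/-- Equality of the sets of attainable totals yields the infimum formula and the transfer of optimal
decompositions at once. -/
theorem exists_hermitian_iff_exists_signed (s : ℝ) :
    (∃ (ι : Type) (_ : Countable ι) (r : ι → ℝ) (X : ι → H →L[ℂ] H)
      (Y : ι → J →L[ℂ] J), IsHermitianStandardDecomposition C r X Y ∧ s = ∑' k, r k) ↔
    ∃ (ι : Type) (_ : Countable ι) (t : ι → ℝ) (ρ : ι → H →L[ℂ] H)
      (σ : ι → J →L[ℂ] J), IsSignedDecomposition C t ρ σ ∧ s = ∑' k, |t k| := by
  constructor
  · rintro ⟨ι, _, r, X, Y, h, rfl⟩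
    obtain ⟨κ, hκ, t, π, ϖ, hd, ht⟩ := h.exists_pure
    exact ⟨κ, hκ, t, π, ϖ, hd.toIsSignedDecomposition, ht.symm⟩
  · rintro ⟨ι, _, t, ρ, σ, h, rfl⟩
    exact ⟨ι, inferInstance, _, _, _, h.hermitian, rfl⟩

theorem exists_hermitian_iff_exists_pure (s : ℝ) :
    (∃ (ι : Type) (_ : Countable ι) (r : ι → ℝ) (X : ι → H →L[ℂ] H)
      (Y : ι → J →L[ℂ] J), IsHermitianStandardDecomposition C r X Y ∧ s = ∑' k, r k) ↔
    ∃ (ι : Type) (_ : Countable ι) (t : ι → ℝ) (π : ι → H →L[ℂ] H)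
      (ϖ : ι → J →L[ℂ] J), IsPureSignedDecomposition C t π ϖ ∧ s = ∑' k, |t k| := by
  constructor
  · rintro ⟨ι, _, r, X, Y, h, rfl⟩
    obtain ⟨κ, hκ, t, π, ϖ, hd, ht⟩ := h.exists_pure
    exact ⟨κ, hκ, t, π, ϖ, hd, ht.symm⟩
  · rintro ⟨ι, _, t, ρ, σ, h, rfl⟩
    exact ⟨ι, inferInstance, _, _, _, h.hermitian, rfl⟩

section Convergence

variable {t : ι → ℝ} {ρ : ι → H →L[ℂ] H} {σ : ι → J →L[ℂ] J}

theorem eHermProjNorm_smul_opTensor_le (c : ℝ) {ρ : H →L[ℂ] H} {σ : J →L[ℂ] J}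
    (hρ : IsDensityOperator ρ) (hσ : IsDensityOperator σ) :
    eHermProjNorm ((c : ℂ) • opTensor ρ σ) ≤ ENNReal.ofReal |c| := by
  have h : IsSignedDecomposition ((c : ℂ) • opTensor ρ σ) (fun _ : Unit => c) (fun _ => ρ)
      (fun _ => σ) := (isSignedDecomposition_iff (Summable.of_finite) (fun _ => hρ) fun _ => hσ).2
        ((OpHasSum.of_fintype _).congr (fun _ => rfl) (by simp))
  simpa using h.hermitian.eHermProjNorm_le

theorem tfae_absSummable (hρ : ∀ k, IsDensityOperator (ρ k)) (hσ : ∀ k, IsDensityOperator (σ k)) :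
    List.TFAE [
      Summable (fun k => |t k|),
      AbsSummableIn eHermProjNorm (fun k => (t k : ℂ) • opTensor (ρ k) (σ k)),
      AbsSummableIn eProjNorm (fun k => (t k : ℂ) • opTensor (ρ k) (σ k)),
      AbsSummableIn eTraceNorm (fun k => (t k : ℂ) • opTensor (ρ k) (σ k))] := by
  tfae_have 1 → 2 := fun h =>
    (ENNReal.tsum_le_tsum fun k => eHermProjNorm_smul_opTensor_le (t k) (hρ k) (hσ k)).trans_lt
      h.tsum_ofReal_lt_top
  tfae_have 2 → 3 := fun h =>
    (ENNReal.tsum_le_tsum fun k => eProjNorm_le_eHermProjNorm _).trans_lt h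
  tfae_have 3 → 4 := fun h =>
    (ENNReal.tsum_le_tsum fun k => eTraceNorm_le_eProjNorm _).trans_lt h
  tfae_have 4 → 1 := fun h => by
    rw [AbsSummableIn] at h
    simp_rw [fun k => ((hρ k).opTensor (hσ k)).eTraceNorm_smul] at h
    simpa [ENNReal.toReal_ofReal] using ENNReal.summable_toReal h.ne
  tfae_finish

theorem HasSumIn.mono {K : Type*} [NormedAddCommGroup K] [InnerProductSpace ℂ K] [CompleteSpace K]
    {M N : (K →L[ℂ] K) → ℝ≥0∞} {f : ι → K →L[ℂ] K} {C : K →L[ℂ] K} (h : HasSumIn N f C)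
    (hMN : ∀ S, M S ≤ N S) : HasSumIn M f C :=
  tendsto_of_tendsto_of_tendsto_of_le_of_le tendsto_const_nhds h (fun _ => zero_le) fun _ => hMN _

theorem tfae_hasSumIn [Countable ι] (hρ : ∀ k, IsDensityOperator (ρ k))
    (hσ : ∀ k, IsDensityOperator (σ k)) (ht : Summable fun k => |t k|)
    (C : HilbertTensor H J →L[ℂ] HilbertTensor H J) :
    List.TFAE [
      HasSumIn eHermProjNorm (fun k => (t k : ℂ) • opTensor (ρ k) (σ k)) C,
      HasSumIn eProjNorm (fun k => (t k : ℂ) • opTensor (ρ k) (σ k)) C,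
      HasSumIn eTraceNorm (fun k => (t k : ℂ) • opTensor (ρ k) (σ k)) C] := by
  tfae_have 1 → 2 := fun h => h.mono eProjNorm_le_eHermProjNorm
  tfae_have 2 → 3 := fun h => h.mono eTraceNorm_le_eProjNorm
  -- Each remainder has the remaining terms as a signed decomposition, so its Hermitian projective
  -- norm is at most the tail of `∑ |t|`.
  tfae_have 3 → 1 := fun h => by
    refine tendsto_of_tendsto_of_tendsto_of_le_of_le tendsto_const_nhds
      (ENNReal.tendsto_tsum_compl_atTop_zero ht.tsum_ofReal_ne_top) (fun _ => zero_le) fun s => ?_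
    have hs : Summable fun k : {k // k ∉ s} => |t k| := ht.comp_injective Subtype.val_injective
    have hd : IsSignedDecomposition (C - ∑ k ∈ s, (t k : ℂ) • opTensor (ρ k) (σ k))
        (fun k : {k // k ∉ s} => t k) (fun k => ρ k) (fun k => σ k) :=
      (isSignedDecomposition_iff hs (fun k => hρ k) fun k => hσ k).2 (h.opHasSum.compl s)
    have h1 := hd.hermitian.eHermProjNorm_le
    rwa [ENNReal.ofReal_tsum_of_nonneg (fun _ => abs_nonneg _) hs] at h1
  tfae_finish

end Convergence

end SignedDecompositions

/-! ### Finite decompositions when one factor is finite dimensional. -/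

section FiniteDecompositions

/-- A real basis of the span is extracted from `S` itself. Its coordinate functionals are
continuous, hence bounded on the bounded set `S`; the `2` is the real dimension of `ℂ`. -/
theorem exists_finite_real_spanning {V : Type*} [NormedAddCommGroup V] [NormedSpace ℂ V]
    [FiniteDimensional ℂ V] (S : Set V) (hS : ∀ x ∈ S, ‖x‖ ≤ 1) :
    ∃ (n : ℕ) (E : Fin n → V) (c : Fin n → V → ℝ) (M : Fin n → ℝ),
      n ≤ 2 * Module.finrank ℂ V ∧ (∀ a, E a ∈ S) ∧ (∀ x ∈ S, x = ∑ a, (c a x : ℂ) • E a) ∧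
      ∀ a, ∀ x ∈ S, |c a x| ≤ M a := by
  have : FiniteDimensional ℝ V := FiniteDimensional.complexToReal V
  obtain ⟨b, hbS, hspan, hli⟩ := exists_linearIndependent ℝ S
  have hfin : Finite b := hli.finite
  have := Fintype.ofFinite b
  let B := Module.Basis.span hli
  have hmem : ∀ x ∈ S, x ∈ Submodule.span ℝ (Set.range ((↑) : b → V)) := fun x hx => by
    rw [Subtype.range_coe, hspan]; exact Submodule.subset_span hx
  let f : b → Submodule.span ℝ (Set.range ((↑) : b → V)) →L[ℝ] ℝ :=
    fun i => (B.coord i).toContinuousLinearMap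
  let e := (Fintype.equivFin b).symm
  classical
  refine ⟨Fintype.card b, fun a => e a, fun a x => if hx : x ∈ S then f (e a) ⟨x, hmem x hx⟩ else 0,
    fun a => ‖f (e a)‖, ?_, fun a => hbS (e a).2, fun x hx => ?_, fun a x hx => ?_⟩
  · rw [← finrank_real_of_complex]
    exact hli.fintype_card_le_finrank
  · simp only [dif_pos hx]
    have h1 := congrArg Subtype.val (B.sum_repr ⟨x, hmem x hx⟩)
    rw [Submodule.coe_sum] at h1
    conv_lhs => rw [← show _ = x from h1]
    rw [← e.sum_comp]
    refine Finset.sum_congr rfl fun a _ => ?_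
    rw [Submodule.coe_smul, Module.Basis.span_apply, Complex.coe_smul]
    rfl
  · simp only [dif_pos hx]
    exact ((f (e a)).le_opNorm _).trans (mul_le_of_le_one_right (norm_nonneg _) (hS x hx))

section Operators

variable {K : Type*} [NormedAddCommGroup K] [InnerProductSpace ℂ K] [CompleteSpace K]

theorem IsDensityOperator.norm_le_one {ρ : K →L[ℂ] K} (h : IsDensityOperator ρ) : ‖ρ‖ ≤ 1 := by
  have := enorm_le_eTraceNorm ρ
  rwa [h.eTraceNorm_eq_one, ← ofReal_norm, ENNReal.ofReal_le_one] at this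

theorem exists_finite_spanning_states [FiniteDimensional ℂ K] :
    ∃ (n : ℕ) (E : Fin n → K →L[ℂ] K) (c : Fin n → (K →L[ℂ] K) → ℝ) (M : Fin n → ℝ),
      n ≤ 2 * Module.finrank ℂ K ^ 2 ∧ (∀ a, IsDensityOperator (E a)) ∧
      (∀ ρ, IsDensityOperator ρ → ρ = ∑ a, (c a ρ : ℂ) • E a) ∧
      ∀ a ρ, IsDensityOperator ρ → |c a ρ| ≤ M a := by
  have hrank : Module.finrank ℂ (K →L[ℂ] K) = Module.finrank ℂ K ^ 2 := by
    rw [← (LinearMap.toContinuousLinearMap (𝕜 := ℂ) (E := K) (F' := K)).finrank_eq,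
      Module.finrank_linearMap, sq]
  have := exists_finite_real_spanning {ρ : K →L[ℂ] K | IsDensityOperator ρ} fun ρ hρ => hρ.norm_le_one
  rwa [hrank] at this

theorem exists_opHasSum_state_of_nonneg {ι : Type*} {s : ι → ℝ} {σ : ι → K →L[ℂ] K}
    (hs : Summable s) (hs0 : ∀ k, 0 ≤ s k) (hσ : ∀ k, IsDensityOperator (σ k)) {σ₀ : K →L[ℂ] K}
    (hσ₀ : IsDensityOperator σ₀) :
    ∃ (p : ℝ) (D : K →L[ℂ] K), IsDensityOperator D ∧
      OpHasSum (fun k => (s k : ℂ) • σ k) ((p : ℂ) • D) := by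
  have hfin : ∑' k, eTraceNorm ((s k : ℂ) • σ k) ≠ ⊤ := by
    simp_rw [fun k => (hσ k).eTraceNorm_smul, fun k => abs_of_nonneg (hs0 k)]
    exact hs.tsum_ofReal_ne_top
  obtain ⟨T, hT⟩ := exists_opHasSum hfin
  have hT0 : 0 ≤ T := hT.nonneg fun k => (hσ k).smul_nonneg (hs0 k)
  have hTt : IsTraceClass T := hT.eTraceNorm_le.trans_lt hfin.lt_top
  rcases eq_or_ne (traceNorm T) 0 with h | h
  · refine ⟨0, σ₀, hσ₀, hT.congr (fun _ => rfl) ?_⟩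
    have h1 := enorm_le_eTraceNorm T
    rw [← hTt.ofReal_traceNorm, h, ENNReal.ofReal_zero, nonpos_iff_eq_zero, enorm_eq_zero] at h1
    simp [h1]
  · refine ⟨traceNorm T, _, isDensityOperator_abs_smul hTt h, hT.congr (fun _ => rfl) ?_⟩
    rw [CFC.abs_of_nonneg T hT0, Complex.coe_smul, smul_smul, mul_inv_cancel₀ h, one_smul]

theorem exists_opHasSum_states {ι : Type*} {s : ι → ℝ} {σ : ι → K →L[ℂ] K}
    (hs : Summable fun k => |s k|) (hσ : ∀ k, IsDensityOperator (σ k)) {σ₀ : K →L[ℂ] K}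
    (hσ₀ : IsDensityOperator σ₀) :
    ∃ (p : Bool → ℝ) (D : Bool → K →L[ℂ] K), (∀ b, IsDensityOperator (D b)) ∧
      OpHasSum (fun k => (s k : ℂ) • σ k) (∑ b, (p b : ℂ) • D b) := by
  have hp : Summable fun k => (s k)⁺ := Summable.of_nonneg_of_le (fun k => posPart_nonneg _)
    (fun k => posPart_add_negPart (s k) ▸ le_add_of_nonneg_right (negPart_nonneg _)) hs
  have hn : Summable fun k => (s k)⁻ := Summable.of_nonneg_of_le (fun k => negPart_nonneg _)
    (fun k => posPart_add_negPart (s k) ▸ le_add_of_nonneg_left (posPart_nonneg _)) hs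
  obtain ⟨p, D, hD, h1⟩ := exists_opHasSum_state_of_nonneg hp (fun k => posPart_nonneg _) hσ hσ₀
  obtain ⟨q, F, hF, h2⟩ := exists_opHasSum_state_of_nonneg hn (fun k => negPart_nonneg _) hσ hσ₀
  refine ⟨fun b => cond b p (-q), fun b => cond b D F, fun b => ?_,
    (h1.add (h2.const_smul (-1))).congr (fun k => ?_) ?_⟩
  · cases b
    exacts [hF, hD]
  · rw [smul_smul, ← add_smul, neg_one_mul, ← sub_eq_add_neg, ← Complex.ofReal_sub,
      posPart_sub_negPart]
  · simp

end Operators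

section Bilinear

variable {H J K : Type*} [NormedAddCommGroup H] [InnerProductSpace ℂ H] [CompleteSpace H]
  [NormedAddCommGroup J] [InnerProductSpace ℂ J] [CompleteSpace J]
  [NormedAddCommGroup K] [InnerProductSpace ℂ K]

/-- Writing `ρ k = ∑ a, c a (ρ k) E a` and exchanging sums pairs each `E a` with `∑ k, t k c a (ρ k)
σ k`, which is a real combination of two states, indexed by `Bool`. A general bilinear `Φ` lets
either tensor factor be the finite dimensional one. -/
theorem exists_finite_expansion [FiniteDimensional ℂ H]
    {Φ : (H →L[ℂ] H) → (J →L[ℂ] J) → K →L[ℂ] K}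
    (hadd₁ : ∀ A A' B, Φ (A + A') B = Φ A B + Φ A' B)
    (hsmul₁ : ∀ (c : ℂ) A B, Φ (c • A) B = c • Φ A B)
    (hadd₂ : ∀ A B B', Φ A (B + B') = Φ A B + Φ A B')
    (hsmul₂ : ∀ A (c : ℂ) B, Φ A (c • B) = c • Φ A B)
    (hΦ : ∀ A B, ‖Φ A B‖ ≤ ‖A‖ * ‖B‖) {ι : Type} {t : ι → ℝ} {ρ : ι → H →L[ℂ] H}
    {σ : ι → J →L[ℂ] J} {C : K →L[ℂ] K} (ht : Summable fun k => |t k|)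
    (hρ : ∀ k, IsDensityOperator (ρ k)) (hσ : ∀ k, IsDensityOperator (σ k))
    (hC : OpHasSum (fun k => (t k : ℂ) • Φ (ρ k) (σ k)) C) (k₀ : ι) :
    ∃ (n : ℕ) (p : Fin n × Bool → ℝ) (E : Fin n × Bool → H →L[ℂ] H)
      (D : Fin n × Bool → J →L[ℂ] J), n ≤ 2 * Module.finrank ℂ H ^ 2 ∧
      (∀ k, IsDensityOperator (E k)) ∧ (∀ k, IsDensityOperator (D k)) ∧
      OpHasSum (fun k => (p k : ℂ) • Φ (E k) (D k)) C := by
  obtain ⟨n, E, c, M, hn, hE, hsum, hM⟩ := exists_finite_spanning_states (K := H)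
  have hs : ∀ a, Summable fun k => |t k * c a (ρ k)| := fun a => by
    refine Summable.of_nonneg_of_le (fun _ => abs_nonneg _) (fun k => ?_) (ht.mul_right (M a))
    rw [abs_mul]
    exact mul_le_mul_of_nonneg_left (hM a _ (hρ k)) (abs_nonneg _)
  choose p D hD hpD using fun a => exists_opHasSum_states (hs a) hσ (hσ k₀)
  have hsum₁ : ∀ (c : Fin n → ℂ) B, Φ (∑ a, c a • E a) B = ∑ a, c a • Φ (E a) B := fun c B => by
    simp_rw [← hsmul₁]
    exact map_sum (AddMonoidHom.mk' (Φ · B) fun A A' => hadd₁ A A' B) (fun a => c a • E a)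
      Finset.univ
  have h1 : OpHasSum (fun k => ∑ a, Φ (E a) (((t k * c a (ρ k) : ℝ) : ℂ) • σ k))
      (∑ a, Φ (E a) (∑ b, (p a b : ℂ) • D a b)) :=
    OpHasSum.sum fun a _ => OpHasSum.map (hpD a) (Φ (E a)) (hadd₂ (E a)) ‖E a‖ (hΦ (E a))
  have h2 : ∑ a, Φ (E a) (∑ b, (p a b : ℂ) • D a b) = C := by
    refine (h1.congr (fun k => ?_) rfl).unique hC
    conv_rhs => rw [hsum (ρ k) (hρ k), hsum₁, Finset.smul_sum]
    refine Finset.sum_congr rfl fun a _ => ?_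
    rw [hsmul₂, smul_smul, Complex.ofReal_mul]
  refine ⟨n, fun k => p k.1 k.2, fun k => E k.1, fun k => D k.1 k.2, hn, fun k => hE _,
    fun k => hD _ _, (OpHasSum.of_fintype _).congr (fun _ => rfl) ?_⟩
  rw [← h2, Fintype.sum_prod_type]
  refine Finset.sum_congr rfl fun a _ => ?_
  simp only [Fintype.sum_bool, hadd₂, hsmul₂]

end Bilinear

section Signed

variable {H J : Type*} [NormedAddCommGroup H] [InnerProductSpace ℂ H] [CompleteSpace H]
  [NormedAddCommGroup J] [InnerProductSpace ℂ J] [CompleteSpace J]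
  {ι κ : Type} {C : HilbertTensor H J →L[ℂ] HilbertTensor H J}
  {t : ι → ℝ} {ρ : ι → H →L[ℂ] H} {σ : ι → J →L[ℂ] J}

theorem OpHasSum.reindex {K : Type*} [NormedAddCommGroup K] [InnerProductSpace ℂ K] {ι κ : Type*}
    {f : ι → K →L[ℂ] K} {C : K →L[ℂ] K} (h : OpHasSum f C) (e : κ ≃ ι) :
    OpHasSum (fun k => f (e k)) C :=
  e.hasSum_iff.2 h

theorem IsSignedDecomposition.reindex (h : IsSignedDecomposition C t ρ σ) (e : κ ≃ ι) :
    IsSignedDecomposition C (fun k => t (e k)) (fun k => ρ (e k)) (fun k => σ (e k)) :=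
  (isSignedDecomposition_iff (e.summable_iff.2 h.summable) (fun k => h.density_left (e k))
    fun k => h.density_right (e k)).2 (h.hasSum.opHasSum.reindex e)

theorem IsSignedDecomposition.exists_fin (h : IsSignedDecomposition C t ρ σ) {m : ℕ}
    (hm : (m : ℕ∞) = min (Cardinal.toENat (Module.rank ℂ H)) (Cardinal.toENat (Module.rank ℂ J))) :
    ∃ (n : ℕ) (t : Fin n → ℝ) (ρ : Fin n → H →L[ℂ] H) (σ : Fin n → J →L[ℂ] J),
      n ≤ 4 * m ^ 2 ∧ IsSignedDecomposition C t ρ σ := by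
  rcases isEmpty_or_nonempty ι with hι | ⟨⟨k₀⟩⟩
  · exact ⟨0, _, _, _, Nat.zero_le _, h.reindex (Equiv.equivOfIsEmpty (Fin 0) ι)⟩
  have hfin : ∀ {n : ℕ} {p : Fin n × Bool → ℝ} {E : Fin n × Bool → H →L[ℂ] H}
      {D : Fin n × Bool → J →L[ℂ] J}, n ≤ 2 * m ^ 2 → (∀ k, IsDensityOperator (E k)) →
      (∀ k, IsDensityOperator (D k)) → OpHasSum (fun k => (p k : ℂ) • opTensor (E k) (D k)) C →
      ∃ (n : ℕ) (t : Fin n → ℝ) (ρ : Fin n → H →L[ℂ] H) (σ : Fin n → J →L[ℂ] J),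
        n ≤ 4 * m ^ 2 ∧ IsSignedDecomposition C t ρ σ := fun {n p E D} hn hE hD hC =>
    ⟨Fintype.card (Fin n × Bool), _, _, _, by
      rw [Fintype.card_prod, Fintype.card_fin, Fintype.card_bool]; omega,
      ((isSignedDecomposition_iff Summable.of_finite hE hD).2 hC).reindex
        (Fintype.equivFin (Fin n × Bool)).symm⟩
  rcases min_choice (Cardinal.toENat (Module.rank ℂ H)) (Cardinal.toENat (Module.rank ℂ J))
    with hmin | hmin
  · rw [hmin] at hm
    have hr : Module.rank ℂ H = m := Cardinal.toENat_eq_natCast.1 hm.symm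
    have : FiniteDimensional ℂ H := FiniteDimensional.of_rank_eq_nat hr
    obtain ⟨n, p, E, D, hn, hE, hD, hC⟩ := exists_finite_expansion (Φ := opTensor)
      opTensor_add_left opTensor_smul_left opTensor_add_right (fun A c B => opTensor_smul_right c A B)
      norm_opTensor_le h.summable h.density_left h.density_right h.hasSum.opHasSum k₀
    rw [Module.finrank_eq_of_rank_eq hr] at hn
    exact hfin hn hE hD hC
  · rw [hmin] at hm
    have hr : Module.rank ℂ J = m := Cardinal.toENat_eq_natCast.1 hm.symm
    have : FiniteDimensional ℂ J := FiniteDimensional.of_rank_eq_nat hr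
    obtain ⟨n, p, E, D, hn, hE, hD, hC⟩ := exists_finite_expansion
      (Φ := fun (B : J →L[ℂ] J) (A : H →L[ℂ] H) => opTensor A B)
      (fun B B' A => opTensor_add_right A B B') (fun c B A => opTensor_smul_right c A B)
      (fun B A A' => opTensor_add_left A A' B) (fun B c A => opTensor_smul_left c A B)
      (fun B A => (norm_opTensor_le A B).trans_eq (mul_comm _ _))
      h.summable h.density_right h.density_left h.hasSum.opHasSum k₀
    rw [Module.finrank_eq_of_rank_eq hr] at hn
    exact hfin hn hD hE hC

end Signed

end FiniteDecompositions

/-! ### The theorem. -/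

theorem mainTheorem8 {H J : Type*}
    [NormedAddCommGroup H] [InnerProductSpace ℂ H] [CompleteSpace H]
    [TopologicalSpace.SeparableSpace H]
    [NormedAddCommGroup J] [InnerProductSpace ℂ J] [CompleteSpace J]
    [TopologicalSpace.SeparableSpace J] :
    -- characterization of the selfadjoint cross trace class, by product states
    -- and by pure product states
    (∀ C : HilbertTensor H J →L[ℂ] HilbertTensor H J,
      (IsSelfAdjointCrossTraceClass C ↔
        IsTraceClass C ∧ ∃ (ι : Type) (_ : Countable ι) (t : ι → ℝ) (ρ : ι → H →L[ℂ] H)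
          (σ : ι → J →L[ℂ] J), IsSignedDecomposition C t ρ σ) ∧
      (IsSelfAdjointCrossTraceClass C ↔
        IsTraceClass C ∧ ∃ (ι : Type) (_ : Countable ι) (t : ι → ℝ) (π : ι → H →L[ℂ] H)
          (ϖ : ι → J →L[ℂ] J), IsPureSignedDecomposition C t π ϖ)) ∧
    -- the three notions of (absolute) convergence are equivalent
    (∀ (ι : Type) [Countable ι] (t : ι → ℝ) (ρ : ι → H →L[ℂ] H) (σ : ι → J →L[ℂ] J),
      (∀ k, IsDensityOperator (ρ k)) → (∀ k, IsDensityOperator (σ k)) →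
      List.TFAE [
        Summable (fun k => |t k|),
        AbsSummableIn eHermProjNorm (fun k => (t k : ℂ) • opTensor (ρ k) (σ k)),
        AbsSummableIn eProjNorm (fun k => (t k : ℂ) • opTensor (ρ k) (σ k)),
        AbsSummableIn eTraceNorm (fun k => (t k : ℂ) • opTensor (ρ k) (σ k))] ∧
      (Summable (fun k => |t k|) → ∀ C : HilbertTensor H J →L[ℂ] HilbertTensor H J,
        List.TFAE [
          HasSumIn eHermProjNorm (fun k => (t k : ℂ) • opTensor (ρ k) (σ k)) C,
          HasSumIn eProjNorm (fun k => (t k : ℂ) • opTensor (ρ k) (σ k)) C,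
          HasSumIn eTraceNorm (fun k => (t k : ℂ) • opTensor (ρ k) (σ k)) C])) ∧
    -- trace and norms of a signed decomposition; passage to a Hermitian standard decomposition
    (∀ (C : HilbertTensor H J →L[ℂ] HilbertTensor H J) (ι : Type) [Countable ι] (t : ι → ℝ)
      (ρ : ι → H →L[ℂ] H) (σ : ι → J →L[ℂ] J), IsSignedDecomposition C t ρ σ →
      opTrace C = ((∑' k, t k : ℝ) : ℂ) ∧
      traceNorm C ≤ projNorm C ∧ projNorm C ≤ hermProjNorm C ∧
      hermProjNorm C ≤ ∑' k, |t k| ∧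
      ∃ (κ : Type) (_ : Countable κ) (r : κ → ℝ) (X : κ → H →L[ℂ] H) (Y : κ → J →L[ℂ] J),
        IsHermitianStandardDecomposition C r X Y ∧ ∑' j, r j = ∑' k, |t k|) ∧
    -- from a Hermitian standard decomposition to signed decompositions
    (∀ (C : HilbertTensor H J →L[ℂ] HilbertTensor H J) (κ : Type) [Countable κ] (r : κ → ℝ)
      (X : κ → H →L[ℂ] H) (Y : κ → J →L[ℂ] J), IsHermitianStandardDecomposition C r X Y →
      (∃ (ι : Type) (_ : Countable ι) (t : ι → ℝ) (ρ : ι → H →L[ℂ] H) (σ : ι → J →L[ℂ] J),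
        IsSignedDecomposition C t ρ σ ∧ ∑' k, |t k| = ∑' j, r j) ∧
      (∃ (ι : Type) (_ : Countable ι) (t : ι → ℝ) (π : ι → H →L[ℂ] H) (ϖ : ι → J →L[ℂ] J),
        IsPureSignedDecomposition C t π ϖ ∧ ∑' k, |t k| = ∑' j, r j)) ∧
    (∀ C : HilbertTensor H J →L[ℂ] HilbertTensor H J, IsSelfAdjointCrossTraceClass C →
      -- both forms of signed decomposition are norming for the Hermitian projective norm
      IsGLB {s : ℝ | ∃ (ι : Type) (_ : Countable ι) (t : ι → ℝ) (ρ : ι → H →L[ℂ] H)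
        (σ : ι → J →L[ℂ] J), IsSignedDecomposition C t ρ σ ∧ s = ∑' k, |t k|}
        (hermProjNorm C) ∧
      IsGLB {s : ℝ | ∃ (ι : Type) (_ : Countable ι) (t : ι → ℝ) (π : ι → H →L[ℂ] H)
        (ϖ : ι → J →L[ℂ] J), IsPureSignedDecomposition C t π ϖ ∧ s = ∑' k, |t k|}
        (hermProjNorm C) ∧
      -- optimally decomposable operators
      (HermNormOptimallyDecomposable C →
        (∃ (ι : Type) (_ : Countable ι) (t : ι → ℝ) (ρ : ι → H →L[ℂ] H) (σ : ι → J →L[ℂ] J),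
          IsSignedDecomposition C t ρ σ ∧ hermProjNorm C = ∑' k, |t k|) ∧
        (∃ (ι : Type) (_ : Countable ι) (t : ι → ℝ) (π : ι → H →L[ℂ] H) (ϖ : ι → J →L[ℂ] J),
          IsPureSignedDecomposition C t π ϖ ∧ hermProjNorm C = ∑' k, |t k|)) ∧
      (HermitianOptimallyDecomposable C →
        HermNormOptimallyDecomposable C ∧
        (∃ (ι : Type) (_ : Countable ι) (t : ι → ℝ) (ρ : ι → H →L[ℂ] H) (σ : ι → J →L[ℂ] J),
          IsSignedDecomposition C t ρ σ ∧
            hermProjNorm C = projNorm C ∧ projNorm C = ∑' k, |t k|) ∧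
        (∃ (ι : Type) (_ : Countable ι) (t : ι → ℝ) (π : ι → H →L[ℂ] H) (ϖ : ι → J →L[ℂ] J),
          IsPureSignedDecomposition C t π ϖ ∧
            hermProjNorm C = projNorm C ∧ projNorm C = ∑' k, |t k|)) ∧
      -- both signs are needed if there is no optimal Hermitian standard decomposition
      (¬ HermNormOptimallyDecomposable C →
        ∀ (ι : Type) [Countable ι] (t : ι → ℝ) (ρ : ι → H →L[ℂ] H) (σ : ι → J →L[ℂ] J),
          IsSignedDecomposition C t ρ σ → (∃ k, 0 < t k) ∧ (∃ k, t k < 0)) ∧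
      -- finite decompositions
      (∀ m : ℕ,
        (m : ℕ∞) = min (Cardinal.toENat (Module.rank ℂ H)) (Cardinal.toENat (Module.rank ℂ J)) →
        ∃ (n : ℕ) (t : Fin n → ℝ) (ρ : Fin n → H →L[ℂ] H) (σ : Fin n → J →L[ℂ] J),
          n ≤ 4 * m ^ 2 ∧ IsSignedDecomposition C t ρ σ)) ∧
    (∀ P : HilbertTensor H J →L[ℂ] HilbertTensor H J, IsSelfAdjointCrossTraceClass P →
      List.TFAE [
        ∃ (ι : Type) (_ : Countable ι) (r : ι → ℝ) (ρ : ι → H →L[ℂ] H) (σ : ι → J →L[ℂ] J),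
          IsPositiveDecomposition P r ρ σ,
        P.IsPositive ∧ HermitianOptimallyDecomposable P ∧ projNorm P = traceNorm P,
        P.IsPositive ∧ HermNormOptimallyDecomposable P ∧ hermProjNorm P = traceNorm P,
        P.IsPositive ∧ OptimallyDecomposable P ∧ projNorm P = traceNorm P,
        P.IsPositive ∧ OptimallyDecomposable P ∧
          hermProjNorm P = projNorm P ∧ projNorm P = traceNorm P] ∧
      -- every positive decomposition is an optimal Hermitian standard decomposition
      (∀ (ι : Type) [Countable ι] (r : ι → ℝ) (ρ : ι → H →L[ℂ] H) (σ : ι → J →L[ℂ] J),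
        IsPositiveDecomposition P r ρ σ →
        IsHermitianStandardDecomposition P r ρ σ ∧
        opTrace P = (traceNorm P : ℂ) ∧ traceNorm P = projNorm P ∧
        projNorm P = hermProjNorm P ∧ hermProjNorm P = ∑' k, r k)) := by
  refine ⟨fun C => ⟨⟨fun h => ?_, ?_⟩, ⟨fun h => ⟨h.1.1, h.exists_pure⟩, ?_⟩⟩,
    fun ι _ t ρ σ hρ hσ => ⟨tfae_absSummable hρ hσ, fun ht C => tfae_hasSumIn hρ hσ ht C⟩,
    fun C ι _ t ρ σ h => ⟨h.opTrace_eq, h.norm_chain.1, h.norm_chain.2.1, h.norm_chain.2.2,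
      ι, inferInstance, _, _, _, h.hermitian, rfl⟩,
    fun C κ _ r X Y h => ⟨?_, h.exists_pure⟩, fun C hC => ?_, fun P hP => ⟨?_, ?_⟩⟩
  · obtain ⟨κ, hκ, t, π, ϖ, hd⟩ := h.exists_pure
    exact ⟨h.1.1, κ, hκ, t, π, ϖ, hd.toIsSignedDecomposition⟩
  · rintro ⟨-, ι, _, t, ρ, σ, h⟩
    exact h.isSelfAdjointCrossTraceClass
  · rintro ⟨-, ι, _, t, ρ, σ, h⟩
    exact h.isSelfAdjointCrossTraceClass
  · obtain ⟨ι, hι, t, π, ϖ, hd, ht⟩ := h.exists_pure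
    exact ⟨ι, hι, t, π, ϖ, hd.toIsSignedDecomposition, ht⟩
  · obtain ⟨κ, _, t, π, ϖ, hd⟩ := hC.exists_pure
    have hglb := isGLB_hermProjNorm hd.hermitian
    refine ⟨?_, ?_, ?_, ?_, fun hn ι _ t ρ σ h => h.exists_pos_and_exists_neg hn,
      fun m hm => hd.exists_fin hm⟩
    · simpa only [exists_hermitian_iff_exists_signed] using hglb
    · simpa only [exists_hermitian_iff_exists_pure] using hglb
    · rintro ⟨ι, hι, r, X, Y, h, hr⟩
      exact ⟨(exists_hermitian_iff_exists_signed _).1 ⟨ι, hι, r, X, Y, h, hr⟩,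
        (exists_hermitian_iff_exists_pure _).1 ⟨ι, hι, r, X, Y, h, hr⟩⟩
    · rintro ⟨ι, hι, r, X, Y, h, hr⟩
      -- The Hermitian decomposition has total `projNorm C`, which therefore bounds `hermProjNorm C`
      -- from above.
      have heq : hermProjNorm C = projNorm C :=
        le_antisymm (hr ▸ h.norm_chain.2.2) h.norm_chain.2.1
      refine ⟨⟨ι, hι, r, X, Y, h, heq.trans hr⟩, ?_, ?_⟩
      · obtain ⟨κ, hκ, t, ρ, σ, hd, ht⟩ :=
          (exists_hermitian_iff_exists_signed (projNorm C)).1 ⟨ι, hι, r, X, Y, h, hr⟩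
        exact ⟨κ, hκ, t, ρ, σ, hd, heq, ht⟩
      · obtain ⟨κ, hκ, t, π, ϖ, hd, ht⟩ :=
          (exists_hermitian_iff_exists_pure (projNorm C)).1 ⟨ι, hι, r, X, Y, h, hr⟩
        exact ⟨κ, hκ, t, π, ϖ, hd, heq, ht⟩
  · tfae_have 1 → 2 := fun ⟨ι, hι, r, ρ, σ, h⟩ =>
      ⟨h.isPositive, ⟨ι, hι, r, ρ, σ, h.isHermitianStandardDecomposition, h.norms_eq.2.1⟩,
        h.norms_eq.2.1.trans h.norms_eq.1.symm⟩
    tfae_have 1 → 3 := fun ⟨ι, hι, r, ρ, σ, h⟩ =>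
      ⟨h.isPositive, ⟨ι, hι, r, ρ, σ, h.isHermitianStandardDecomposition, h.norms_eq.2.2⟩,
        h.norms_eq.2.2.trans h.norms_eq.1.symm⟩
    tfae_have 1 → 5 := fun ⟨ι, hι, r, ρ, σ, h⟩ =>
      ⟨h.isPositive, ⟨ι, hι, r, ρ, σ,
        h.isHermitianStandardDecomposition.toIsStandardDecomposition, h.norms_eq.2.1⟩,
        h.norms_eq.2.2.trans h.norms_eq.2.1.symm, h.norms_eq.2.1.trans h.norms_eq.1.symm⟩
    tfae_have 2 → 4 := fun ⟨hpos, ⟨ι, hι, r, X, Y, h, hr⟩, hn⟩ =>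
      ⟨hpos, ⟨ι, hι, r, X, Y, h.toIsStandardDecomposition, hr⟩, hn⟩
    tfae_have 5 → 4 := fun ⟨hpos, hopt, _, hn⟩ => ⟨hpos, hopt, hn⟩
    tfae_have 3 → 1 := fun ⟨hpos, ⟨ι, hι, r, X, Y, h, hr⟩, hn⟩ => by
      obtain ⟨ρ, σ, hd⟩ :=
        h.toIsStandardDecomposition.exists_isPositiveDecomposition hpos (hr.symm.trans hn)
      exact ⟨ι, hι, r, ρ, σ, hd⟩
    -- Attainment and equality of norms give `∑ r = ‖P‖₁`; the factors need not be selfadjoint,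
    -- since they are replaced by their absolute values.
    tfae_have 4 → 1 := fun ⟨hpos, ⟨ι, hι, r, X, Y, h, hr⟩, hn⟩ => by
      obtain ⟨ρ, σ, hd⟩ := h.exists_isPositiveDecomposition hpos (hr.symm.trans hn)
      exact ⟨ι, hι, r, ρ, σ, hd⟩
    tfae_finish
  · intro ι _ r ρ σ h
    obtain ⟨h1, h2, h3⟩ := h.norms_eq
    exact ⟨h.isHermitianStandardDecomposition,
      opTrace_of_nonneg ((ContinuousLinearMap.nonneg_iff_isPositive P).2 h.isPositive),
      h1.trans h2.symm, h2.trans h3.symm, h3⟩
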